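/- Let $M$ be the space of trace-zero $2\times 2$ matrices over $\mathbb{F}_3$, on which $G=\operatorname{SL}_2(\mathbb{F}_3)$ acts by conjugation, $g(v)=gvg^{-1}$, and let $G$ act on $M^*$ by $(g(f))(v)=f(g^{-1}(v))$. Let $x_1,x_2,x_3$ be the basis of $M^*$ dual to the basis $$v_1=\begin{pmatrix}0&1\\-1&0\end{pmatrix},\quad v_2=\begin{pmatrix}-1&-1\\-1&1\end{pmatrix},\quad v_3=\begin{pmatrix}1&-1\\-1&-1\end{pmatrix}$$ of $M$. Let $R=S(M^*)\otimes\Lambda(M^*)$, where $x_1,x_2,x_3$ generate $S(M^*)$ and $y_1,y_2,y_3$ denote the same basis of $M^*$ regarded as generators of $\Lambda(M^*)$; with $\deg x_i=2$ and $\deg y_i=1$ this is a graded-commutative $\mathbb{F}_3$-algebra. Let $G$ act on $R$ by the algebra automorphisms extending the action on $M^*$ in both factors, and let $R^G$ be the subalgebra of invariants. Put $$a_1=x_1^2+x_2^2+x_3^2,\quad a_2=x_1x_2x_3,\quad a_3=x_1^4+x_2^4+x_3^4,\quad b=x_1^4x_2^2+x_1^2x_3^4+x_2^4x_3^2,$$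 $$\begin{aligned} c_1&=x_1y_1+x_2y_2+x_3y_3, & d_1&=x_1y_2y_3+x_2y_3y_1+x_3y_1y_2,\\ c_2&=x_2x_3y_1+x_3x_1y_2+x_1x_2y_3, & d_2&=x_2x_3y_2y_3+x_3x_1y_3y_1+x_1x_2y_1y_2,\\ c_3&=x_1^3y_1+x_2^3y_2+x_3^3y_3, & d_3&=x_1^3y_2y_3+x_2^3y_3y_1+x_3^3y_1y_2,\\ c_4&=x_1x_2^2y_1+x_2x_3^2y_2+x_3x_1^2y_3, & d_4&=x_1x_2^2y_2y_3+x_2x_3^2y_3y_1+x_3x_1^2y_1y_2,\\ c_5&=x_2^3x_3y_1+x_3^3x_1y_2+x_1^3x_2y_3, & d_5&=x_2^3x_3y_2y_3+x_3^3x_1y_3y_1+x_1^3x_2y_1y_2,\\ c_6&=x_1^3x_2^2y_1+x_2^3x_3^2y_2+x_3^3x_1^2y_3, & d_6&=x_1^3x_2^2y_2y_3+x_2^3x_3^2y_3y_1+x_3^3x_1^2y_1y_2. \end{aligned}$$ Then the 14 elements $$a_1,\ a_2,\ a_3,\ b,\ c_1,\ldots,c_6,\ d_1,\ d_2,\ d_3,\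 y_1y_2y_3$$ are pairwise distinct and form a minimal generating set of the graded-commutative $\mathbb{F}_3$-algebra $R^G$: they generate $R^G$ as an $\mathbb{F}_3$-algebra, and no proper subset of them does. Moreover, the following relations hold (so that $d_4,d_5,d_6$ are redundant as generators): $$\begin{aligned} c_1c_2&=-d_4-a_1d_1+d_3,\\ c_1c_3&=a_1d_2+d_5-a_2d_1,\\ c_2c_3&=-d_6+a_1d_4-a_1d_3+a_2d_2-a_3d_1-a_1^2d_1. \end{aligned}$$ -/

import Mathlib

open scoped TensorProduct

noncomputable section

namespace DiffInv

/-- The prime field with three elements. -/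
abbrev F3 : Type := ZMod 3

/-- The group `SL₂(𝔽₃)`. -/
abbrev G : Type := Matrix.SpecialLinearGroup (Fin 2) F3

/-- The space of `2 × 2` matrices over `𝔽₃` of trace zero. -/
abbrev M : Submodule F3 (Matrix (Fin 2) (Fin 2) F3) :=
  LinearMap.ker (Matrix.traceLinearMap (Fin 2) F3 F3)

/-- The conjugation action `g • m = g m g⁻¹` of `SL₂(𝔽₃)` on the trace-zero matrices. -/
def conj : Representation F3 G M where
  toFun g :=
    { toFun := fun m =>
        ⟨(g : Matrix (Fin 2) (Fin 2) F3) * (m : Matrix (Fin 2) (Fin 2) F3) *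
            ((g⁻¹ : G) : Matrix (Fin 2) (Fin 2) F3), by
          have hm : Matrix.trace (m : Matrix (Fin 2) (Fin 2) F3) = 0 := m.2
          have hg : ((g⁻¹ : G) : Matrix (Fin 2) (Fin 2) F3) *
              (g : Matrix (Fin 2) (Fin 2) F3) = 1 := by
            rw [← Matrix.SpecialLinearGroup.coe_mul, inv_mul_cancel,
              Matrix.SpecialLinearGroup.coe_one]
          rw [LinearMap.mem_ker, Matrix.traceLinearMap_apply, Matrix.trace_mul_comm,
            ← mul_assoc, hg, one_mul, hm]⟩
      map_add' := fun m n => by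
        ext1
        simp [mul_add, add_mul]
      map_smul' := fun r m => by
        ext1
        simp }
  map_one' := by
    ext1 m
    ext1
    simp
  map_mul' g h := by
    ext1 m
    ext1
    simp only [mul_inv_rev, Matrix.SpecialLinearGroup.coe_mul, Module.End.mul_apply,
      LinearMap.coe_mk, AddHom.coe_mk, mul_assoc]

/-- The contragredient action `(g f)(m) = f (g⁻¹ m)` on the dual space `M*`. -/
def dualAction : Representation F3 G (Module.Dual F3 M) := conj.dual

/-- The algebra `R = S(M*) ⊗ Λ(M*)` of differential forms on `M`. The multiplication is
`(f ⊗ ω)(f' ⊗ ω') = f f' ⊗ ω ω'`; no sign occurs because `S(M*)` sits in even degrees. -/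
abbrev R : Type :=
  SymmetricAlgebra F3 (Module.Dual F3 M) ⊗[F3] ExteriorAlgebra F3 (Module.Dual F3 M)

/-- A linear endomorphism of `M*` extended to an algebra endomorphism of `S(M*)`. -/
def symMap (f : Module.Dual F3 M →ₗ[F3] Module.Dual F3 M) :
    SymmetricAlgebra F3 (Module.Dual F3 M) →ₐ[F3] SymmetricAlgebra F3 (Module.Dual F3 M) :=
  SymmetricAlgebra.lift (SymmetricAlgebra.ι F3 (Module.Dual F3 M) ∘ₗ f)

/-- The action of `SL₂(𝔽₃)` on `R` by algebra endomorphisms that extends the action on `M*` in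
both tensor factors. -/
def action : G →* (R →ₐ[F3] R) where
  toFun g := Algebra.TensorProduct.map (symMap (dualAction g)) (ExteriorAlgebra.map (dualAction g))
  map_one' := by
    have h1 : symMap (dualAction 1) = AlgHom.id F3 _ := by
      apply SymmetricAlgebra.algHom_ext
      ext1 f
      rw [map_one]
      exact SymmetricAlgebra.lift_ι_apply _ _
    have h2 : ExteriorAlgebra.map (dualAction 1) = AlgHom.id F3 _ := by
      rw [map_one]
      exact ExteriorAlgebra.map_id
    rw [h1, h2, Algebra.TensorProduct.map_id]
    rfl
  map_mul' g h := by
    have h1 : symMap (dualAction (g * h)) =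
        (symMap (dualAction g)).comp (symMap (dualAction h)) := by
      apply SymmetricAlgebra.algHom_ext
      ext1 f
      have hs : ∀ (u : Module.Dual F3 M →ₗ[F3] Module.Dual F3 M) (w : Module.Dual F3 M),
          symMap u (SymmetricAlgebra.ι F3 _ w) = SymmetricAlgebra.ι F3 _ (u w) :=
        fun u w => SymmetricAlgebra.lift_ι_apply _ _
      change symMap _ (SymmetricAlgebra.ι F3 _ f) =
        symMap _ (symMap _ (SymmetricAlgebra.ι F3 _ f))
      rw [hs, hs, hs, map_mul, Module.End.mul_apply]
    have h2 : ExteriorAlgebra.map (dualAction (g * h)) =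
        (ExteriorAlgebra.map (dualAction g)).comp (ExteriorAlgebra.map (dualAction h)) := by
      rw [map_mul, ExteriorAlgebra.map_comp_map]
      rfl
    rw [h1, h2, Algebra.TensorProduct.map_comp]
    rfl

/-- The algebra `R^G` of differential invariants. -/
def invariants : Subalgebra F3 R where
  carrier := {r | ∀ g : G, action g r = r}
  mul_mem' ha hb g := by rw [map_mul, ha g, hb g]
  add_mem' ha hb g := by rw [map_add, ha g, hb g]
  algebraMap_mem' r g := AlgHom.commutes _ r

/-- The three trace-zero matrices that form the chosen basis of `M`. -/
def vec : Fin 3 → M :=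
  ![⟨!![0, 1; -1, 0], by simp [Matrix.trace_fin_two]⟩,
    ⟨!![-1, -1; -1, 1], by simp [Matrix.trace_fin_two]⟩,
    ⟨!![1, -1; -1, -1], by simp [Matrix.trace_fin_two]⟩]

theorem vec_linearIndependent : LinearIndependent F3 vec := by
  rw [Fintype.linearIndependent_iff]
  intro c hc
  have h := congrArg (Subtype.val : M → Matrix (Fin 2) (Fin 2) F3) hc
  have h00 := congrFun (congrFun h 0) 0
  have h01 := congrFun (congrFun h 0) 1
  have h10 := congrFun (congrFun h 1) 0
  simp [Fin.sum_univ_three, vec] at h00 h01 h10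
  have key : ∀ p q r : F3, -q + r = 0 → p + -q + -r = 0 → -p + -q + -r = 0 →
      p = 0 ∧ q = 0 ∧ r = 0 := by decide
  obtain ⟨h0, h1, h2⟩ := key _ _ _ h00 h01 h10
  intro i
  fin_cases i
  · exact h0
  · exact h1
  · exact h2

theorem vec_span : ⊤ ≤ Submodule.span F3 (Set.range vec) := by
  intro m _
  have ht : (m : Matrix (Fin 2) (Fin 2) F3) 0 0 + (m : Matrix (Fin 2) (Fin 2) F3) 1 1 = 0 := by
    have := m.2
    rwa [LinearMap.mem_ker, Matrix.traceLinearMap_apply, Matrix.trace_fin_two] at this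
  have key : ∀ p q r s : F3, p + s = 0 →
      (-(p - q - r) + -(p + q + r) = p ∧ (r - q) + -(p - q - r) + (p + q + r) = q) ∧
      (-(r - q) + -(p - q - r) + (p + q + r) = r ∧ (p - q - r) + (p + q + r) = s) := by decide
  set p := (m : Matrix (Fin 2) (Fin 2) F3) 0 0 with hp
  set q := (m : Matrix (Fin 2) (Fin 2) F3) 0 1 with hq
  set r := (m : Matrix (Fin 2) (Fin 2) F3) 1 0 with hr
  set s := (m : Matrix (Fin 2) (Fin 2) F3) 1 1 with hs
  obtain ⟨⟨e1, e2⟩, e3, e4⟩ := key p q r s ht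
  have hm : m = (r - q) • vec 0 + (p - q - r) • vec 1 + (-(p + q + r)) • vec 2 := by
    apply Subtype.ext
    ext i j
    fin_cases i <;> fin_cases j
    · simpa [vec] using e1.symm
    · simpa [vec] using e2.symm
    · simpa [vec] using e3.symm
    · simpa [vec] using e4.symm
  rw [hm]
  refine Submodule.add_mem _ (Submodule.add_mem _ ?_ ?_) ?_ <;>
    exact Submodule.smul_mem _ _ (Submodule.subset_span (Set.mem_range_self _))

/-- The basis `v₁, v₂, v₃` of `M`. -/
def v : Module.Basis (Fin 3) F3 M := Module.Basis.mk vec_linearIndependent vec_span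

/-- The dual basis in `S(M*)`, viewed in `R`; `x 0`, `x 1`, `x 2` are `x₁`, `x₂`, `x₃`. -/
def x (i : Fin 3) : R := SymmetricAlgebra.ι F3 (Module.Dual F3 M) (v.coord i) ⊗ₜ[F3] 1

/-- The dual basis in `Λ(M*)`, viewed in `R`; `y 0`, `y 1`, `y 2` are `y₁`, `y₂`, `y₃`. -/
def y (i : Fin 3) : R := 1 ⊗ₜ[F3] ExteriorAlgebra.ι F3 (v.coord i)

def a1 : R := x 0 ^ 2 + x 1 ^ 2 + x 2 ^ 2
def a2 : R := x 0 * x 1 * x 2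
def a3 : R := x 0 ^ 4 + x 1 ^ 4 + x 2 ^ 4
def b : R := x 0 ^ 4 * x 1 ^ 2 + x 0 ^ 2 * x 2 ^ 4 + x 1 ^ 4 * x 2 ^ 2

def c1 : R := x 0 * y 0 + x 1 * y 1 + x 2 * y 2
def c2 : R := x 1 * x 2 * y 0 + x 2 * x 0 * y 1 + x 0 * x 1 * y 2
def c3 : R := x 0 ^ 3 * y 0 + x 1 ^ 3 * y 1 + x 2 ^ 3 * y 2
def c4 : R := x 0 * x 1 ^ 2 * y 0 + x 1 * x 2 ^ 2 * y 1 + x 2 * x 0 ^ 2 * y 2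
def c5 : R := x 1 ^ 3 * x 2 * y 0 + x 2 ^ 3 * x 0 * y 1 + x 0 ^ 3 * x 1 * y 2
def c6 : R := x 0 ^ 3 * x 1 ^ 2 * y 0 + x 1 ^ 3 * x 2 ^ 2 * y 1 + x 2 ^ 3 * x 0 ^ 2 * y 2

def d1 : R := x 0 * (y 1 * y 2) + x 1 * (y 2 * y 0) + x 2 * (y 0 * y 1)
def d2 : R :=
  x 1 * x 2 * (y 1 * y 2) + x 2 * x 0 * (y 2 * y 0) + x 0 * x 1 * (y 0 * y 1)
def d3 : R := x 0 ^ 3 * (y 1 * y 2) + x 1 ^ 3 * (y 2 * y 0) + x 2 ^ 3 * (y 0 * y 1)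
def d4 : R :=
  x 0 * x 1 ^ 2 * (y 1 * y 2) + x 1 * x 2 ^ 2 * (y 2 * y 0) + x 2 * x 0 ^ 2 * (y 0 * y 1)
def d5 : R :=
  x 1 ^ 3 * x 2 * (y 1 * y 2) + x 2 ^ 3 * x 0 * (y 2 * y 0) + x 0 ^ 3 * x 1 * (y 0 * y 1)
def d6 : R :=
  x 0 ^ 3 * x 1 ^ 2 * (y 1 * y 2) + x 1 ^ 3 * x 2 ^ 2 * (y 2 * y 0) +
    x 2 ^ 3 * x 0 ^ 2 * (y 0 * y 1)

/-- The proposed set of generators of `R^G`. -/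
def generators : Set R :=
  {a1, a2, a3, b, c1, c2, c3, c4, c5, c6, d1, d2, d3, y 0 * y 1 * y 2}

/-- `s` generates the subalgebra `B`, and no proper subset of `s` does. -/
def IsMinimalGeneratingSet {A : Type*} [Ring A] [Algebra F3 A] (B : Subalgebra F3 A)
    (s : Set A) : Prop :=
  Algebra.adjoin F3 s = B ∧ ∀ t : Set A, t ⊂ s → Algebra.adjoin F3 t ≠ B

end DiffInv

end

open scoped TensorProduct

noncomputable section

namespace DiffInv

open Matrix MvPolynomial

/-! The algebra R is a free module over P = F₃[x₁,x₂,x₃] on 1, the y_i, the products y₂y₃, y₃y₁,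
y₁y₂, and y₁y₂y₃. The group is generated by two elements: `gCyc`, which permutes the indices
cyclically, and `gSgn`, which has signs 1, -1, -1. So a form is invariant exactly when its outer
coefficients are invariant polynomials and its two coefficient vectors are cyclic orbits of a first
coefficient with prescribed parities. The condition is the same in degrees one and two
(`form_mem_invariants`).

Generation: put A, B, C = x₁², x₂², x₃². Their elementary symmetric functions are a₁, a₃ - a₁² (in
characteristic 3) and a₂², and F₃[A,B,C] is spanned over symmetric polynomials by six monomials
(`mul_monomial_mem`). Parity makes an admissible first coefficient a combination of x₁ and x₂x₃ over
F₃[A,B,C]; reducing the six monomials leaves the coefficients of c₁, …, c₆ (`semiinvariant_mem`).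
The same argument gives d₁, …, d₆ in degree two, and the three relations remove d₄, d₅, d₆
(`d_mem`). An invariant polynomial is a sum of powers of a₂ and cyclic traces, which leads to 1 and
b over F₃[a₁,a₂,a₃] (`invariant_mem`).

Minimality: each generator has a linear functional with value 1 on it and 0 on the other generators,
on 1, and on everything of the form (generator)(generator)r (`funct_gen`, `funct_gen_gen`). Such a
generator is not in the algebra generated by the others (`adjoin_ne_of_ssubset_range`). -/

/-- The polynomial ring in `x₁, x₂, x₃`. -/
abbrev P : Type := MvPolynomial (Fin 3) F3

/-! ### Differential forms as a free module of rank eight over the polynomial ring -/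

/-- Coordinates of differential forms over `P`: the coefficient of `1`, those of `y₁, y₂, y₃`,
those of `y₂y₃, y₃y₁, y₁y₂`, and that of `y₁y₂y₃`. -/
abbrev Coords : Type := P × (Fin 3 → P) × (Fin 3 → P) × P

/-- Exterior multiplication by the `1`-form with coefficients `u`, in coordinates. -/
def wedge : (Fin 3 → P) →ₗ[P] Module.End P Coords :=
  LinearMap.mk₂ P (fun u z => (0, z.1 • u, u ⨯₃ z.2.1, u ⬝ᵥ z.2.2.1))
    (fun u u' z => by
      simp only [smul_add, map_add, LinearMap.add_apply, add_dotProduct, Prod.mk_add_mk, add_zero])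
    (fun a u z => by simp [smul_comm z.1 a u])
    (fun u z z' => by simp [add_smul])
    (fun a u z => by simp [mul_smul])

@[simp]
theorem wedge_apply (u : Fin 3 → P) (z : Coords) :
    wedge u z = (0, z.1 • u, u ⨯₃ z.2.1, u ⬝ᵥ z.2.2.1) := rfl

/-- This rests on u × u = 0 and u · (u × w) = 0, and is the relation demanded by the universal
property of the exterior algebra. -/
theorem wedge_mul_self (u : Fin 3 → P) : wedge u * wedge u = 0 := by
  refine LinearMap.ext fun z => ?_
  simp [Module.End.mul_apply, dot_self_cross]

/-- A linear form on `M` acts on coordinates by exterior multiplication. -/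
def wedgeDual : Module.Dual F3 M →ₗ[F3] Module.End P Coords where
  toFun f := wedge fun i => C (f (v i))
  map_add' f g := by
    rw [← map_add]
    congr 1
    ext1 i
    exact map_add C _ _
  map_smul' r f := by
    rw [RingHom.id_apply, ← algebraMap_smul P r (wedge _), ← map_smul]
    congr 1
    ext1 i
    exact map_mul C _ _

theorem wedgeDual_mul_self (f : Module.Dual F3 M) : wedgeDual f * wedgeDual f = 0 :=
  wedge_mul_self _

/-- The symmetric algebra of `M*` as a polynomial ring. -/
def symEquiv : SymmetricAlgebra F3 (Module.Dual F3 M) ≃ₐ[F3] P :=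
  SymmetricAlgebra.equivMvPolynomial v.dualBasis

theorem symEquiv_ι (i : Fin 3) :
    symEquiv (SymmetricAlgebra.ι F3 (Module.Dual F3 M) (v.coord i)) = X i := by
  rw [← v.coe_dualBasis]
  exact SymmetricAlgebra.equivMvPolynomial_ι_apply _ _

/-- The action of the exterior algebra on coordinates by left multiplication. -/
def extMul : ExteriorAlgebra F3 (Module.Dual F3 M) →ₐ[F3] Module.End P Coords :=
  ExteriorAlgebra.lift F3 ⟨wedgeDual, wedgeDual_mul_self⟩

theorem extMul_ι (f : Module.Dual F3 M) :
    extMul (ExteriorAlgebra.ι F3 f) = wedge fun i => C (f (v i)) :=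
  ExteriorAlgebra.lift_ι_apply _ _ _ _

/-- The action of the symmetric algebra on coordinates by left multiplication. -/
def symMul : SymmetricAlgebra F3 (Module.Dual F3 M) →ₐ[F3] Module.End P Coords :=
  ((Algebra.ofId P (Module.End P Coords)).restrictScalars F3).comp symEquiv.toAlgHom

theorem symMul_apply (p : SymmetricAlgebra F3 (Module.Dual F3 M)) (z : Coords) :
    symMul p z = symEquiv p • z := rfl

/-- The action of `R` on coordinates by left multiplication. -/
def leftMul : R →ₐ[F3] Module.End P Coords :=
  Algebra.TensorProduct.lift symMul extMul
    (fun p _ => Algebra.commutes (A := Module.End P Coords) (symEquiv p) _)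

theorem leftMul_tmul (p : SymmetricAlgebra F3 (Module.Dual F3 M))
    (w : ExteriorAlgebra F3 (Module.Dual F3 M)) : leftMul (p ⊗ₜ w) = symMul p * extMul w :=
  Algebra.TensorProduct.lift_tmul _ _ _ _ _

theorem leftMul_y (i : Fin 3) : leftMul (y i) = wedge (Pi.single i 1) := by
  have h : (fun j => C (v.coord i (v j))) = (Pi.single i 1 : Fin 3 → P) := by
    ext1 j
    by_cases hij : j = i
    · simp [hij]
    · simp [hij]
  rw [y, leftMul_tmul, map_one, one_mul, extMul_ι, h]

/-- The inclusion of the polynomial ring into `R`. -/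
def incl : P →ₐ[F3] R := Algebra.TensorProduct.includeLeft.comp symEquiv.symm.toAlgHom

theorem incl_apply (p : P) : incl p = symEquiv.symm p ⊗ₜ 1 := rfl

theorem incl_X (i : Fin 3) : incl (X i) = x i := by
  rw [incl_apply, ← symEquiv_ι, AlgEquiv.symm_apply_apply, x]

theorem incl_commutes (p : P) (r : R) : incl p * r = r * incl p :=
  Algebra.commutes (symEquiv.symm p) r

theorem leftMul_incl (p : P) (z : Coords) : leftMul (incl p) z = p • z := by
  rw [incl_apply, leftMul_tmul, map_one, mul_one, symMul_apply, AlgEquiv.apply_symm_apply]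

theorem y_mul_self (i : Fin 3) : y i * y i = 0 := by
  rw [y, Algebra.TensorProduct.tmul_mul_tmul, ExteriorAlgebra.ι_sq_zero, TensorProduct.tmul_zero]

theorem y_mul_swap (i j : Fin 3) : y j * y i = -(y i * y j) := by
  rw [eq_neg_iff_add_eq_zero, y, y, Algebra.TensorProduct.tmul_mul_tmul,
    Algebra.TensorProduct.tmul_mul_tmul, ← TensorProduct.tmul_add,
    ExteriorAlgebra.ι_add_mul_swap, TensorProduct.tmul_zero]

section Abstract

variable {A : Type*} [Ring A] (φ : P →+* A) (e : Fin 3 → A)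

/-- The element of a ring `A` over `P` with given coordinates with respect to the ordered monomials
in three elements `e` of `A`. -/
def formIn (z : Coords) : A :=
  φ z.1 + (φ (z.2.1 0) * e 0 + φ (z.2.1 1) * e 1 + φ (z.2.1 2) * e 2) +
    (φ (z.2.2.1 0) * (e 1 * e 2) + φ (z.2.2.1 1) * (e 2 * e 0) + φ (z.2.2.1 2) * (e 0 * e 1)) +
    φ z.2.2.2 * (e 0 * e 1 * e 2)

theorem formIn_add (z z' : Coords) : formIn φ e (z + z') = formIn φ e z + formIn φ e z' := by
  simp only [formIn, Prod.fst_add, Prod.snd_add, Pi.add_apply, map_add, add_mul]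
  abel

theorem formIn_smul (p : P) (z : Coords) : formIn φ e (p • z) = φ p * formIn φ e z := by
  simp only [formIn, Prod.smul_fst, Prod.smul_snd, Pi.smul_apply, smul_eq_mul, map_mul, mul_add,
    mul_assoc]

/-- Only centrality of the coefficients and anticommutation of the `e i` matter; sorting the
monomials produces the signs of the cross product. -/
theorem formIn_wedge (hφ : ∀ p a, φ p * a = a * φ p) (h0 : ∀ i, e i * e i = 0)
    (h : ∀ i j, e j * e i = -(e i * e j)) (i : Fin 3) (z : Coords) :
    formIn φ e (wedge (Pi.single i 1) z) = e i * formIn φ e z := by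
  have hc : ∀ (p : P) (k : Fin 3) (a : A), e k * (φ p * a) = φ p * (e k * a) := fun p k a => by
    rw [← mul_assoc, ← hφ, mul_assoc]
  have hs : ∀ (k : Fin 3) (a : A), e k * (e k * a) = 0 := fun k a => by
    rw [← mul_assoc, h0, zero_mul]
  have h10 : ∀ a, e 1 * (e 0 * a) = -(e 0 * (e 1 * a)) := fun a => by
    rw [← mul_assoc, h 0 1, neg_mul, mul_assoc]
  have h20 : ∀ a, e 2 * (e 0 * a) = -(e 0 * (e 2 * a)) := fun a => by
    rw [← mul_assoc, h 0 2, neg_mul, mul_assoc]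
  have h21 : ∀ a, e 2 * (e 1 * a) = -(e 1 * (e 2 * a)) := fun a => by
    rw [← mul_assoc, h 1 2, neg_mul, mul_assoc]
  fin_cases i <;>
  · simp [formIn, cross_apply, mul_add, hc, ← hφ _ (e _), hs, h0, h 0 1, h 0 2,
      h 1 2, h10, h20, h21, mul_assoc]
    try abel

end Abstract

/-- The differential form with given coordinates. -/
def form (z : Coords) : R := formIn incl.toRingHom y z

theorem form_add (z z' : Coords) : form (z + z') = form z + form z' := formIn_add _ _ _ _

theorem form_smul (p : P) (z : Coords) : form (p • z) = incl p * form z := formIn_smul _ _ _ _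

theorem form_wedge (i : Fin 3) (z : Coords) :
    form (wedge (Pi.single i 1) z) = y i * form z :=
  formIn_wedge _ _ incl_commutes y_mul_self y_mul_swap i z

theorem dual_eq_sum (f : Module.Dual F3 M) : f = ∑ i, f (v i) • v.coord i := by
  refine v.ext fun j => ?_
  simp

theorem form_leftMul_symm (p : SymmetricAlgebra F3 (Module.Dual F3 M)) (z : Coords) :
    form (leftMul (p ⊗ₜ 1) z) = p ⊗ₜ 1 * form z := by
  have h : (p ⊗ₜ 1 : R) = incl (symEquiv p) := by
    rw [incl_apply, AlgEquiv.symm_apply_apply]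
  rw [h, leftMul_incl, form_smul]

/-- The inclusion of the exterior algebra into `R`. -/
def inclExt : ExteriorAlgebra F3 (Module.Dual F3 M) →ₐ[F3] R := Algebra.TensorProduct.includeRight

theorem inclExt_apply (w : ExteriorAlgebra F3 (Module.Dual F3 M)) : inclExt w = 1 ⊗ₜ w := rfl

theorem inclExt_ι (f : Module.Dual F3 M) :
    inclExt (ExteriorAlgebra.ι F3 f) = ∑ i, incl (C (f (v i))) * y i := by
  conv_lhs => rw [dual_eq_sum f, map_sum, map_sum]
  refine Finset.sum_congr rfl fun i _ => ?_
  rw [map_smul, map_smul, ← MvPolynomial.algebraMap_eq, AlgHom.commutes, ← Algebra.smul_def, y,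
    inclExt_apply]

theorem form_leftMul_ext (w : ExteriorAlgebra F3 (Module.Dual F3 M)) (z : Coords) :
    form (leftMul (inclExt w) z) = inclExt w * form z := by
  induction w using ExteriorAlgebra.induction generalizing z with
  | algebraMap r =>
    have h : inclExt (algebraMap F3 _ r) = incl (algebraMap F3 _ r) := by
      rw [AlgHom.commutes, AlgHom.commutes]
    rw [h, leftMul_incl, form_smul]
  | ι f =>
    have hs : ∀ (s : Finset (Fin 3)) (g : Fin 3 → Coords),
        form (∑ i ∈ s, g i) = ∑ i ∈ s, form (g i) := fun s g =>
      map_sum (AddMonoidHom.mk' form form_add) g s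
    rw [inclExt_ι, map_sum, LinearMap.sum_apply, hs, Finset.sum_mul]
    refine Finset.sum_congr rfl fun i _ => ?_
    rw [map_mul, Module.End.mul_apply, leftMul_incl, form_smul, leftMul_y, form_wedge, mul_assoc]
  | mul a b ha hb => rw [map_mul, map_mul, Module.End.mul_apply, ha, hb, mul_assoc]
  | add a b ha hb => rw [map_add, map_add, LinearMap.add_apply, form_add, ha, hb, add_mul]

/-- Linearity of `form` over R makes `coords`, the orbit map of the coordinate vector of 1, a right
inverse of `form`. -/
theorem form_leftMul (r : R) (z : Coords) : form (leftMul r z) = r * form z := by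
  induction r using TensorProduct.induction_on generalizing z with
  | zero =>
    rw [map_zero, LinearMap.zero_apply, zero_mul]
    have h := form_smul 0 0
    rwa [map_zero, zero_mul, zero_smul] at h
  | tmul p w =>
    have h : (p ⊗ₜ w : R) = p ⊗ₜ 1 * inclExt w := by
      rw [inclExt_apply, Algebra.TensorProduct.tmul_mul_tmul, one_mul, mul_one]
    rw [h, map_mul, Module.End.mul_apply, form_leftMul_symm, form_leftMul_ext, mul_assoc]
  | add a b ha hb => rw [map_add, LinearMap.add_apply, form_add, ha, hb, add_mul]

/-- The coordinates of a differential form. -/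
def coords : R →ₗ[F3] Coords where
  toFun r := leftMul r (1, 0, 0, 0)
  map_add' r r' := by rw [map_add, LinearMap.add_apply]
  map_smul' c r := by rw [map_smul, LinearMap.smul_apply, RingHom.id_apply]

theorem coords_apply (r : R) : coords r = leftMul r (1, 0, 0, 0) := rfl

theorem form_coords (r : R) : form (coords r) = r := by
  rw [coords_apply, form_leftMul]
  have h : form (1, 0, 0, 0) = 1 := by
    simp only [form, formIn, Pi.zero_apply, map_zero, zero_mul, add_zero, map_one]
  rw [h, mul_one]

theorem coords_injective : Function.Injective coords :=
  Function.LeftInverse.injective form_coords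

theorem coords_mul (r r' : R) : coords (r * r') = leftMul r (coords r') := by
  rw [coords_apply, map_mul, Module.End.mul_apply, coords_apply]

theorem form_eq (z : Coords) : form z = incl z.1 +
    (incl (z.2.1 0) * y 0 + incl (z.2.1 1) * y 1 + incl (z.2.1 2) * y 2) +
    (incl (z.2.2.1 0) * (y 1 * y 2) + incl (z.2.2.1 1) * (y 2 * y 0) +
      incl (z.2.2.1 2) * (y 0 * y 1)) +
    incl z.2.2.2 * (y 0 * y 1 * y 2) := rfl

/-- Left multiplication by a `1`-form. -/
theorem leftMul_oneForm (u : Fin 3 → P) (z : Coords) :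
    leftMul (incl (u 0) * y 0 + incl (u 1) * y 1 + incl (u 2) * y 2) z = wedge u z := by
  have hu : u = u 0 • Pi.single 0 1 + u 1 • Pi.single 1 1 + u 2 • Pi.single 2 1 := by
    ext1 i
    fin_cases i <;> simp
  conv_rhs => rw [hu]
  simp only [map_add, map_mul, LinearMap.add_apply, Module.End.mul_apply, leftMul_incl, leftMul_y,
    map_smul, LinearMap.smul_apply]

/-- Left multiplication by a `2`-form. -/
theorem leftMul_twoForm (u : Fin 3 → P) (z : Coords) :
    leftMul (incl (u 0) * (y 1 * y 2) + incl (u 1) * (y 2 * y 0) + incl (u 2) * (y 0 * y 1)) z =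
      (0, 0, z.1 • u, u ⬝ᵥ z.2.1) := by
  simp only [map_add, map_mul, LinearMap.add_apply, Module.End.mul_apply, leftMul_incl, leftMul_y]
  ext i <;> (try fin_cases i) <;> simp [cross_apply, vec3_dotProduct, mul_comm]

/-- Left multiplication by a `3`-form. -/
theorem leftMul_threeForm (p : P) (z : Coords) :
    leftMul (incl p * (y 0 * y 1 * y 2)) z = (0, 0, 0, p * z.1) := by
  simp only [map_mul, Module.End.mul_apply, leftMul_incl, leftMul_y]
  ext i <;> (try fin_cases i) <;> simp [cross_apply]

/-- This is the linear independence over P of the eight monomials in the y_i. -/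
theorem coords_form (z : Coords) : coords (form z) = z := by
  rw [form_eq, coords_apply, map_add, map_add, map_add, LinearMap.add_apply, LinearMap.add_apply,
    LinearMap.add_apply, leftMul_oneForm, leftMul_twoForm, leftMul_threeForm, leftMul_incl]
  simp

/-! ### Two generators of the group and their action on R -/

/-- The element of `SL₂(𝔽₃)` that permutes the basis `v` cyclically. -/
def gCyc : G := ⟨!![1, 1; 0, 1], by simp [det_fin_two]⟩

/-- The element of `SL₂(𝔽₃)` that fixes `v₁` and changes the signs of `v₂` and `v₃`. -/
def gSgn : G := ⟨!![0, 1; -1, 0], by simp [det_fin_two]⟩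

/-- The first two matrices generate the quaternion subgroup, with normal form iᵃjᵇ; the third
generates a complement of order 3. The count 4 · 2 · 3 = 24 is the group order. -/
theorem exists_word : ∀ p q r s : F3, p * s - q * r = 1 → ∃ (a : Fin 4) (b : Fin 2) (c : Fin 3),
    (!![p, q; r, s] : Matrix (Fin 2) (Fin 2) F3) =
      !![0, 1; -1, 0] ^ (a : ℕ) * !![-1, -1; -1, 1] ^ (b : ℕ) * !![1, 1; 0, 1] ^ (c : ℕ) := by
  decide +kernel

theorem coe_inv_gCyc : ((gCyc⁻¹ : G) : Matrix (Fin 2) (Fin 2) F3) = !![1, -1; 0, 1] := by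
  refine (Matrix.SpecialLinearGroup.coe_inv gCyc).trans ?_
  simp [gCyc, adjugate_fin_two]

theorem coe_inv_gSgn : ((gSgn⁻¹ : G) : Matrix (Fin 2) (Fin 2) F3) = !![0, -1; 1, 0] := by
  refine (Matrix.SpecialLinearGroup.coe_inv gSgn).trans ?_
  simp [gSgn, adjugate_fin_two]

theorem mem_closure_gSgn_gCyc (g : G) : g ∈ Subgroup.closure {gSgn, gCyc} := by
  obtain ⟨a, b, c, h⟩ := exists_word (g.1 0 0) (g.1 0 1) (g.1 1 0) (g.1 1 1)
    (by rw [← det_fin_two]; exact g.2)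
  -- The second quaternion matrix is the conjugate of `gSgn` by `gCyc`, so it needs no generator of
  -- its own.
  have hg : g = gSgn ^ (a : ℕ) * (gCyc * gSgn * gCyc⁻¹) ^ (b : ℕ) * gCyc ^ (c : ℕ) := by
    apply Subtype.ext
    rw [← eta_fin_two] at h
    rw [h]
    have h1 : gCyc.1 * gSgn.1 * (gCyc⁻¹ : G).1 = !![-1, -1; -1, 1] := by
      rw [coe_inv_gCyc, gCyc, gSgn]
      decide +kernel
    rw [← h1]
    rfl
  have h1 : gSgn ∈ Subgroup.closure {gSgn, gCyc} := Subgroup.subset_closure (by simp)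
  have h2 : gCyc ∈ Subgroup.closure {gSgn, gCyc} := Subgroup.subset_closure (by simp)
  rw [hg]
  exact mul_mem (mul_mem (pow_mem h1 _) (pow_mem (mul_mem (mul_mem h2 h1) (inv_mem h2)) _))
    (pow_mem h2 _)

theorem mem_invariants_iff (r : R) :
    r ∈ invariants ↔ action gSgn r = r ∧ action gCyc r = r := by
  refine ⟨fun h => ⟨h _, h _⟩, fun h g => ?_⟩
  induction mem_closure_gSgn_gCyc g using Subgroup.closure_induction with
  | mem g hg =>
    rcases hg with rfl | rfl
    · exact h.1
    · exact h.2
  | one => rw [map_one]; rfl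
  | mul g g' _ _ hg hg' => rw [map_mul]; exact (congrArg _ hg').trans hg
  | inv g _ hg =>
    conv_lhs => rw [← hg]
    have : (action g⁻¹ * action g) r = r := by rw [← map_mul, inv_mul_cancel, map_one]; rfl
    exact this

theorem conj_gCyc_symm (j : Fin 3) : conj gCyc⁻¹ (v j) = v (j - 1) := by
  rw [v, Module.Basis.mk_apply, Module.Basis.mk_apply]
  apply Subtype.ext
  change ((gCyc⁻¹ : G) : Matrix (Fin 2) (Fin 2) F3) * (vec j : Matrix (Fin 2) (Fin 2) F3) *
    ((gCyc⁻¹⁻¹ : G) : Matrix (Fin 2) (Fin 2) F3) = _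
  rw [inv_inv, coe_inv_gCyc]
  revert j
  simp only [gCyc, vec]
  decide +kernel

/-- The signs of the action of `gSgn`. -/
def sign : Fin 3 → F3 := ![1, -1, -1]

theorem conj_gSgn_symm (j : Fin 3) : conj gSgn⁻¹ (v j) = sign j • v j := by
  rw [v, Module.Basis.mk_apply]
  apply Subtype.ext
  change ((gSgn⁻¹ : G) : Matrix (Fin 2) (Fin 2) F3) * (vec j : Matrix (Fin 2) (Fin 2) F3) *
    ((gSgn⁻¹⁻¹ : G) : Matrix (Fin 2) (Fin 2) F3) = sign j • (vec j : Matrix (Fin 2) (Fin 2) F3)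
  rw [inv_inv, coe_inv_gSgn]
  revert j
  simp only [gSgn, vec]
  decide +kernel

theorem dualAction_gCyc (i : Fin 3) : dualAction gCyc (v.coord i) = v.coord (i + 1) := by
  refine v.ext fun j => ?_
  have h : dualAction gCyc (v.coord i) (v j) = v.coord i (conj gCyc⁻¹ (v j)) := rfl
  rw [h, conj_gCyc_symm, v.coord_apply, v.coord_apply, v.repr_self, v.repr_self,
    Finsupp.single_apply, Finsupp.single_apply]
  exact if_congr sub_eq_iff_eq_add rfl rfl

theorem dualAction_gSgn (i : Fin 3) : dualAction gSgn (v.coord i) = sign i • v.coord i := by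
  refine v.ext fun j => ?_
  have h : dualAction gSgn (v.coord i) (v j) = v.coord i (conj gSgn⁻¹ (v j)) := rfl
  rw [h, conj_gSgn_symm, map_smul, LinearMap.smul_apply, v.coord_apply, v.repr_self]
  by_cases hij : j = i
  · rw [hij]
  · rw [Finsupp.single_eq_of_ne' hij, smul_zero, smul_zero]

theorem action_x (g : G) (i : Fin 3) :
    action g (x i) = SymmetricAlgebra.ι F3 (Module.Dual F3 M) (dualAction g (v.coord i)) ⊗ₜ 1 := by
  have h : action g (x i) = symMap (dualAction g) (SymmetricAlgebra.ι F3 _ (v.coord i)) ⊗ₜ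
      ExteriorAlgebra.map (dualAction g) 1 := rfl
  rw [h, map_one, symMap, SymmetricAlgebra.lift_ι_apply, LinearMap.comp_apply]

theorem action_y (g : G) (i : Fin 3) :
    action g (y i) = 1 ⊗ₜ ExteriorAlgebra.ι F3 (dualAction g (v.coord i)) := by
  have h : action g (y i) = symMap (dualAction g) 1 ⊗ₜ
      ExteriorAlgebra.map (dualAction g) (ExteriorAlgebra.ι F3 (v.coord i)) := rfl
  rw [h, map_one, ExteriorAlgebra.map_apply_ι]

theorem action_gCyc_x (i : Fin 3) : action gCyc (x i) = x (i + 1) := by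
  rw [action_x, dualAction_gCyc, x]

theorem action_gCyc_y (i : Fin 3) : action gCyc (y i) = y (i + 1) := by
  rw [action_y, dualAction_gCyc, y]

theorem action_gSgn_x (i : Fin 3) : action gSgn (x i) = sign i • x i := by
  rw [action_x, dualAction_gSgn, x, map_smul, TensorProduct.smul_tmul']

theorem action_gSgn_y (i : Fin 3) : action gSgn (y i) = sign i • y i := by
  rw [action_y, dualAction_gSgn, y, map_smul, TensorProduct.tmul_smul]

/-! ### Invariance in coordinates -/

/-- The cyclic permutation of the variables. -/
def cyc : P →ₐ[F3] P := rename (· + 1)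

theorem cyc_X (i : Fin 3) : cyc (X i) = X (i + 1) := rename_X _ _

/-- The change of sign of the last two variables. -/
def sgn : P →ₐ[F3] P := aeval fun i => sign i • X i

theorem sgn_X (i : Fin 3) : sgn (X i) = sign i • X i := aeval_X _ _

theorem action_gCyc_incl (p : P) : action gCyc (incl p) = incl (cyc p) := by
  have h : (action gCyc).comp incl = incl.comp cyc := by
    refine MvPolynomial.algHom_ext fun i => ?_
    rw [AlgHom.comp_apply, AlgHom.comp_apply, incl_X, cyc_X, incl_X, action_gCyc_x]
  exact DFunLike.congr_fun h p

theorem action_gSgn_incl (p : P) : action gSgn (incl p) = incl (sgn p) := by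
  have h : (action gSgn).comp incl = incl.comp sgn := by
    refine MvPolynomial.algHom_ext fun i => ?_
    rw [AlgHom.comp_apply, AlgHom.comp_apply, incl_X, sgn_X, map_smul, incl_X, action_gSgn_x]
  exact DFunLike.congr_fun h p

section Abstract

variable {A : Type*} [Ring A] [Algebra F3 A] (φ : P →ₐ[F3] A) (e : Fin 3 → A)

/-- The ordering e₂e₃, e₃e₁, e₁e₂ is permuted cyclically without signs, and the top product is fixed
because a 3-cycle is even. -/
theorem formIn_cyc (h : ∀ i j, e j * e i = -(e i * e j)) (z : Coords) :
    formIn φ.toRingHom (fun i => e (i + 1)) z =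
      formIn φ.toRingHom e
        (z.1, fun i => z.2.1 (i - 1), fun i => z.2.2.1 (i - 1), z.2.2.2) := by
  have h3 : e 1 * e 2 * e 0 = e 0 * e 1 * e 2 := by
    rw [mul_assoc, h 0 2, mul_neg, ← mul_assoc, h 0 1, neg_mul, neg_neg]
  have e1 : (0 - 1 : Fin 3) = 2 := rfl
  have e2 : (1 - 1 : Fin 3) = 0 := rfl
  have e3 : (2 - 1 : Fin 3) = 1 := rfl
  have e4 : (0 + 1 : Fin 3) = 1 := rfl
  have e5 : (1 + 1 : Fin 3) = 2 := rfl
  have e6 : (2 + 1 : Fin 3) = 0 := rfl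
  simp only [formIn, e1, e2, e3, e4, e5, e6, h3]
  abel

/-- The product of any two of the signs 1, -1, -1 is the remaining one, so two-forms carry the same
signs as one-forms. -/
theorem formIn_sgn (z : Coords) :
    formIn φ.toRingHom (fun i => sign i • e i) z =
      formIn φ.toRingHom e
        (z.1, fun i => sign i • z.2.1 i, fun i => sign i • z.2.2.1 i, z.2.2.2) := by
  have e1 : sign 0 = 1 := rfl
  have e2 : sign 1 = -1 := rfl
  have e3 : sign 2 = -1 := rfl
  simp [formIn, e1, e2, e3]

end Abstract

/-- Coordinatewise application of an endomorphism of the polynomial ring. -/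
def mapCoords (ψ : P →ₐ[F3] P) (z : Coords) : Coords :=
  (ψ z.1, fun i => ψ (z.2.1 i), fun i => ψ (z.2.2.1 i), ψ z.2.2.2)

theorem action_form (g : G) (ψ : P →ₐ[F3] P) (h : ∀ p, action g (incl p) = incl (ψ p))
    (z : Coords) : action g (form z) =
      formIn incl.toRingHom (fun i => action g (y i)) (mapCoords ψ z) := by
  simp only [form_eq, map_add, map_mul, h]
  rfl

theorem action_gCyc_form (z : Coords) : action gCyc (form z) =
    form (cyc z.1, fun i => cyc (z.2.1 (i - 1)), fun i => cyc (z.2.2.1 (i - 1)), cyc z.2.2.2) := by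
  rw [action_form _ _ action_gCyc_incl, funext action_gCyc_y]
  exact formIn_cyc _ _ y_mul_swap _

theorem action_gSgn_form (z : Coords) : action gSgn (form z) =
    form (sgn z.1, fun i => sign i • sgn (z.2.1 i), fun i => sign i • sgn (z.2.2.1 i),
      sgn z.2.2.2) := by
  rw [action_form _ _ action_gSgn_incl, funext action_gSgn_y]
  exact formIn_sgn _ _ _

theorem form_mem_invariants (z : Coords) : form z ∈ invariants ↔
    (sgn z.1 = z.1 ∧ cyc z.1 = z.1) ∧
    ((∀ i, sgn (z.2.1 i) = sign i • z.2.1 i) ∧ ∀ i, z.2.1 (i + 1) = cyc (z.2.1 i)) ∧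
    ((∀ i, sgn (z.2.2.1 i) = sign i • z.2.2.1 i) ∧ ∀ i, z.2.2.1 (i + 1) = cyc (z.2.2.1 i)) ∧
    (sgn z.2.2.2 = z.2.2.2 ∧ cyc z.2.2.2 = z.2.2.2) := by
  have hinj : Function.Injective form := Function.LeftInverse.injective coords_form
  have hs : ∀ u : Fin 3 → P, (fun i => sign i • sgn (u i)) = u ↔ ∀ i, sgn (u i) = sign i • u i := by
    intro u
    have h : ∀ i, sign i * sign i = 1 := by decide
    refine funext_iff.trans (forall_congr' fun i => ⟨fun e => ?_, fun e => ?_⟩)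
    · conv_rhs => rw [← e]
      rw [smul_smul, h, one_smul]
    · rw [e, smul_smul, h, one_smul]
  have hc : ∀ u : Fin 3 → P, (fun i => cyc (u (i - 1))) = u ↔ ∀ i, u (i + 1) = cyc (u i) := by
    intro u
    refine funext_iff.trans ⟨fun e i => ?_, fun e i => ?_⟩
    · rw [← e (i + 1), add_sub_cancel_right]
    · rw [← e, sub_add_cancel]
  rw [mem_invariants_iff, action_gSgn_form, action_gCyc_form, hinj.eq_iff, hinj.eq_iff]
  simp only [Prod.ext_iff, hs, hc]
  tauto

/-! ### Coefficient functionals dual to the generators -/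

/-- The exponent vector of `x₁ⁱx₂ʲx₃ᵏ`. -/
def expo (i j k : ℕ) : Fin 3 →₀ ℕ := Finsupp.equivFunOnFinite.symm ![i, j, k]

/-- The coefficient of `x₁ⁱx₂ʲx₃ᵏ`. -/
def cf (i j k : ℕ) : P →ₗ[F3] F3 := lcoeff F3 (expo i j k)

theorem cf_X0_pow_mul (n i j k : ℕ) (p : P) :
    cf i j k (X 0 ^ n * p) = if n ≤ i then cf (i - n) j k p else 0 := by
  have h : Finsupp.single 0 n ≤ expo i j k ↔ n ≤ i := by
    simp [Finsupp.single_le_iff, expo]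
  have h' : expo i j k - Finsupp.single 0 n = expo (i - n) j k := by
    ext a
    fin_cases a <;> simp [expo]
  rw [cf, cf, lcoeff_apply, lcoeff_apply, X_pow_eq_monomial, coeff_monomial_mul', one_mul, h']
  exact if_congr h rfl rfl

theorem cf_X1_pow_mul (n i j k : ℕ) (p : P) :
    cf i j k (X 1 ^ n * p) = if n ≤ j then cf i (j - n) k p else 0 := by
  have h : Finsupp.single 1 n ≤ expo i j k ↔ n ≤ j := by
    simp [Finsupp.single_le_iff, expo]
  have h' : expo i j k - Finsupp.single 1 n = expo i (j - n) k := by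
    ext a
    fin_cases a <;> simp [expo]
  rw [cf, cf, lcoeff_apply, lcoeff_apply, X_pow_eq_monomial, coeff_monomial_mul', one_mul, h']
  exact if_congr h rfl rfl

theorem cf_X2_pow_mul (n i j k : ℕ) (p : P) :
    cf i j k (X 2 ^ n * p) = if n ≤ k then cf i j (k - n) p else 0 := by
  have h : Finsupp.single 2 n ≤ expo i j k ↔ n ≤ k := by
    simp [Finsupp.single_le_iff, expo]
  have h' : expo i j k - Finsupp.single 2 n = expo i j (k - n) := by
    ext a
    fin_cases a <;> simp [expo]
  rw [cf, cf, lcoeff_apply, lcoeff_apply, X_pow_eq_monomial, coeff_monomial_mul', one_mul, h']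
  exact if_congr h rfl rfl

theorem cf_X0_mul (i j k : ℕ) (p : P) :
    cf i j k (X 0 * p) = if 1 ≤ i then cf (i - 1) j k p else 0 := by
  simpa using cf_X0_pow_mul 1 i j k p

theorem cf_X1_mul (i j k : ℕ) (p : P) :
    cf i j k (X 1 * p) = if 1 ≤ j then cf i (j - 1) k p else 0 := by
  simpa using cf_X1_pow_mul 1 i j k p

theorem cf_X2_mul (i j k : ℕ) (p : P) :
    cf i j k (X 2 * p) = if 1 ≤ k then cf i j (k - 1) p else 0 := by
  simpa using cf_X2_pow_mul 1 i j k p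

theorem cf_one (i j k : ℕ) : cf i j k 1 = if i = 0 ∧ j = 0 ∧ k = 0 then 1 else 0 := by
  rw [cf, lcoeff_apply, coeff_one]
  refine if_congr ?_ rfl rfl
  rw [DFunLike.ext_iff, Fin.forall_fin_succ, Fin.forall_fin_succ, Fin.forall_fin_succ]
  simp [expo, eq_comm]

/-- The polynomial invariants `a₁, a₂, a₃, b`. -/
def polyA : Fin 4 → P :=
  ![X 0 ^ 2 + X 1 ^ 2 + X 2 ^ 2, X 0 * X 1 * X 2, X 0 ^ 4 + X 1 ^ 4 + X 2 ^ 4,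
    X 0 ^ 4 * X 1 ^ 2 + X 0 ^ 2 * X 2 ^ 4 + X 1 ^ 4 * X 2 ^ 2]

/-- The first coefficients of `c₁, …, c₆` and of `d₁, …, d₆`. -/
def polyC : Fin 6 → P :=
  ![X 0, X 1 * X 2, X 0 ^ 3, X 0 * X 1 ^ 2, X 1 ^ 3 * X 2, X 0 ^ 3 * X 1 ^ 2]

/-- The coefficient vector of the cyclically invariant form with a given first coefficient. -/
def orbit (f : P) : Fin 3 → P := ![f, cyc f, cyc (cyc f)]

/-- Functionals dual to `a₁, a₂, a₃, b`. -/
def functA : Fin 4 → P →ₗ[F3] F3 :=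
  ![cf 2 0 0, cf 1 1 1, cf 2 0 2 - cf 4 0 0 - cf 0 0 4, cf 6 0 0 - cf 4 0 2 + cf 2 0 4 - cf 0 0 6]

/-- Functionals dual to `c₁, …, c₆`. -/
def functC : Fin 6 → P →ₗ[F3] F3 :=
  ![cf 1 0 0, cf 0 1 1, cf 3 0 0 - cf 1 0 2, cf 1 2 0 - cf 1 0 2, cf 0 3 1 - cf 0 1 3,
    cf 3 2 0 - cf 3 0 2 - cf 1 4 0 + cf 1 0 4]

/-- Functionals dual to `d₁, d₂, d₃`. -/
def functD : Fin 3 → P →ₗ[F3] F3 :=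
  ![cf 1 0 0, cf 0 1 1, cf 3 0 0 + cf 1 2 0 + cf 1 0 2]

theorem functA_polyA (i j : Fin 4) : functA i (polyA j) = if i = j then 1 else 0 := by
  rw [← mul_one (polyA j)]
  fin_cases i <;> fin_cases j <;>
    simp [functA, polyA, add_mul, mul_assoc, cf_X0_mul, cf_X1_mul, cf_X2_mul, cf_X0_pow_mul,
      cf_X1_pow_mul, cf_X2_pow_mul, cf_one, -mul_one]
  -- Here -1 - 1 = 1 in F₃ normalizes the functional of a₃.
  decide

/-- The first two functionals look below degree 4, the least degree of a product. The last two see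
only monomials free of x₂: there a₂ vanishes, a₁ becomes A + C and a₃ becomes A² + C², and modulo 3
the weights annihilate the multiples of (A + C)² and of (A + C)(A² + C²). -/
theorem functA_polyA_mul (i j k : Fin 4) (p : P) : functA i (polyA j * (polyA k * p)) = 0 := by
  fin_cases i <;> fin_cases j <;> fin_cases k <;>
    simp [functA, polyA, add_mul, mul_add, mul_assoc, cf_X0_mul, cf_X1_mul, cf_X2_mul,
      cf_X0_pow_mul, cf_X1_pow_mul, cf_X2_pow_mul]

theorem functC_polyC (i j : Fin 6) : functC i (polyC j) = if i = j then 1 else 0 := by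
  rw [← mul_one (polyC j)]
  fin_cases i <;> fin_cases j <;>
    simp [functC, polyC, mul_assoc, cf_X0_mul, cf_X1_mul, cf_X0_pow_mul,
      cf_X1_pow_mul, cf_X2_mul, cf_one, -mul_one]

/-- Every exponent vector used contains a zero, which disposes of a₂; b has too large a degree; the
contributions of a₁ and a₃ cancel. Since p is arbitrary, the functionals vanish on the whole ideal
of P generated by the a's and b. -/
theorem functC_polyA_mul (i : Fin 6) (j : Fin 4) (p : P) : functC i (polyA j * p) = 0 := by
  fin_cases i <;> fin_cases j <;>
    simp [functC, polyA, add_mul, mul_assoc, cf_X0_mul, cf_X1_mul, cf_X2_mul, cf_X0_pow_mul,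
      cf_X1_pow_mul, cf_X2_pow_mul]

/-- The first coefficients of `d₁, d₂, d₃`. -/
def polyD (j : Fin 3) : P := polyC (j.castLE (by decide))

theorem functD_polyD (i j : Fin 3) : functD i (polyD j) = if i = j then 1 else 0 := by
  rw [← mul_one (polyD j)]
  fin_cases i <;> fin_cases j <;>
    simp [functD, polyD, polyC, mul_assoc, cf_X0_mul, cf_X1_mul, cf_X0_pow_mul, cf_X2_mul,
      cf_one, -mul_one]

theorem add_add_self : ∀ r : F3, r + (r + r) = 0 := by decide

theorem functD_polyA_mul (i : Fin 3) (j : Fin 4) (p : P) : functD i (polyA j * p) = 0 := by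
  fin_cases i <;> fin_cases j <;>
    simp [functD, polyA, add_mul, mul_assoc, cf_X0_mul, cf_X1_mul, cf_X2_mul, cf_X0_pow_mul,
      cf_X1_pow_mul, cf_X2_pow_mul, add_assoc, add_add_self]

theorem cyc_X0 : cyc (X 0) = X 1 := cyc_X 0
theorem cyc_X1 : cyc (X 1) = X 2 := cyc_X 1
theorem cyc_X2 : cyc (X 2) = X 0 := cyc_X 2

/-- Products of two c's also land in degree two. The only nonzero one of low enough degree is, up to
sign, c₁c₂, with first coefficient x₁(x₂² - x₃²), on which the equal weights of x₁x₂² and x₁x₃²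
cancel. -/
theorem functD_cross (i : Fin 3) (j k : Fin 6) (p : P) :
    functD i ((orbit (polyC j) ⨯₃ orbit (polyC k)) 0 * p) = 0 := by
  fin_cases i <;> fin_cases j <;> fin_cases k <;>
    simp [functD, polyC, orbit, cross_apply, cyc_X0, cyc_X1, cyc_X2, sub_mul, mul_assoc, cf_X0_mul,
      cf_X1_mul, cf_X2_mul, cf_X0_pow_mul, cf_X1_pow_mul, cf_X2_pow_mul]

theorem cf_zero_orbit_mul (j : Fin 6) (l : Fin 3) (p : P) :
    cf 0 0 0 (orbit (polyC j) l * p) = 0 := by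
  fin_cases j <;> fin_cases l <;>
    simp [polyC, orbit, cyc_X0, cyc_X1, cyc_X2, mul_assoc, cf_X0_mul,
      cf_X1_mul, cf_X2_mul, cf_X0_pow_mul, cf_X1_pow_mul, cf_X2_pow_mul]

theorem cf_zero_polyA_mul (j : Fin 4) (p : P) : cf 0 0 0 (polyA j * p) = 0 := by
  fin_cases j <;>
    simp [polyA, add_mul, mul_assoc, cf_X0_mul, cf_X0_pow_mul, cf_X1_pow_mul, cf_X2_pow_mul]

/-! ### The generators in coordinates -/

/-- The differential form of degree one with given coefficients. -/
def oneForm (u : Fin 3 → P) : R := incl (u 0) * y 0 + incl (u 1) * y 1 + incl (u 2) * y 2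

/-- The differential form of degree two with given coefficients. -/
def twoForm (u : Fin 3 → P) : R :=
  incl (u 0) * (y 1 * y 2) + incl (u 1) * (y 2 * y 0) + incl (u 2) * (y 0 * y 1)

/-- The index set of the generators. -/
abbrev Idx : Type := Fin 4 ⊕ Fin 6 ⊕ Fin 3 ⊕ Unit

/-- The fourteen generators. -/
def gen : Idx → R :=
  Sum.elim (fun j => incl (polyA j)) (Sum.elim (fun j => oneForm (orbit (polyC j)))
    (Sum.elim (fun j => twoForm (orbit (polyD j))) fun _ => y 0 * y 1 * y 2))

theorem incl_polyA_zero : incl (polyA 0) = a1 := by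
  simp only [polyA, a1, map_add, map_pow, incl_X, cons_val]

theorem incl_polyA_one : incl (polyA 1) = a2 := by
  simp only [polyA, a2, map_mul, incl_X, cons_val]

theorem incl_polyA_two : incl (polyA 2) = a3 := by
  simp only [polyA, a3, map_add, map_pow, incl_X, cons_val]

theorem incl_polyA_three : incl (polyA 3) = b := by
  simp only [polyA, b, map_add, map_mul, map_pow, incl_X, cons_val]

theorem oneForm_orbit (f : P) : oneForm (orbit f) =
    incl f * y 0 + incl (cyc f) * y 1 + incl (cyc (cyc f)) * y 2 := rfl

theorem twoForm_orbit (f : P) : twoForm (orbit f) =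
    incl f * (y 1 * y 2) + incl (cyc f) * (y 2 * y 0) + incl (cyc (cyc f)) * (y 0 * y 1) := rfl

theorem oneForm_polyC : (fun j => oneForm (orbit (polyC j))) = ![c1, c2, c3, c4, c5, c6] := by
  ext1 j
  fin_cases j <;> simp only [polyC, oneForm_orbit, c1, c2, c3, c4, c5, c6, map_mul, map_pow,
    cyc_X0, cyc_X1, cyc_X2, incl_X, cons_val, Fin.zero_eta, Fin.mk_one, Fin.reduceFinMk]

theorem twoForm_polyC : (fun j => twoForm (orbit (polyC j))) = ![d1, d2, d3, d4, d5, d6] := by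
  ext1 j
  fin_cases j <;> simp only [polyC, twoForm_orbit, d1, d2, d3, d4, d5, d6, map_mul, map_pow,
    cyc_X0, cyc_X1, cyc_X2, incl_X, cons_val, Fin.zero_eta, Fin.mk_one, Fin.reduceFinMk]

theorem range_gen : Set.range gen = generators := by
  have hA : (fun j => incl (polyA j)) = ![a1, a2, a3, b] := by
    ext1 j
    fin_cases j
    exacts [incl_polyA_zero, incl_polyA_one, incl_polyA_two, incl_polyA_three]
  have hD : (fun j => twoForm (orbit (polyD j))) = ![d1, d2, d3] := by
    ext1 j
    refine (congrFun twoForm_polyC _).trans ?_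
    fin_cases j <;> rfl
  rw [gen, hA, hD, oneForm_polyC, Set.Sum.elim_range, Set.Sum.elim_range, Set.Sum.elim_range,
    Set.range_const]
  simp only [range_cons, range_empty, Set.union_empty, generators]
  ext r
  simp only [Set.mem_union, Set.mem_singleton_iff, Set.mem_insert_iff]
  tauto

/-! ### Minimality -/

/-- A family with dual functionals that vanish on `1` and on multiples of products of two members
is a minimal generating set of the algebra it generates. -/
theorem adjoin_ne_of_ssubset_range {k A ι : Type*} [Field k] [Ring A] [Algebra k A]
    (g : ι → A) (L : ι → A →ₗ[k] k) (h1 : ∀ i, L i 1 = 0) (hg : ∀ i, L i (g i) = 1)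
    (hne : ∀ i j, i ≠ j → L i (g j) = 0) (hmul : ∀ i j l r, L i (g j * (g l * r)) = 0)
    (t : Set A) (ht : t ⊂ Set.range g) : Algebra.adjoin k t ≠ Algebra.adjoin k (Set.range g) := by
  obtain ⟨hsub, hnot⟩ := ht
  obtain ⟨_, ⟨i, rfl⟩, hi⟩ := Set.not_subset.1 hnot
  intro he
  -- Words in `t` have length zero, one, or at least two; those of length one avoid `g i`, since `g
  -- i` is not in `t`.
  have hclosure : ∀ m ∈ Submonoid.closure t, m = 1 ∨ (∃ j, j ≠ i ∧ m = g j) ∨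
      ∃ j l r, m = g j * (g l * r) := by
    intro m hm
    induction hm using Submonoid.closure_induction_left with
    | one => exact Or.inl rfl
    | mul_left x hx m _ ih =>
      obtain ⟨j, rfl⟩ := hsub hx
      have hj : j ≠ i := fun h => hi (h ▸ hx)
      rcases ih with rfl | ⟨l, -, rfl⟩ | ⟨l, l', r, rfl⟩
      · exact Or.inr (Or.inl ⟨j, hj, mul_one _⟩)
      · exact Or.inr (Or.inr ⟨j, l, 1, by rw [mul_one]⟩)
      · exact Or.inr (Or.inr ⟨j, l, _, rfl⟩)
  have hle : Submodule.span k (Submonoid.closure t : Set A) ≤ LinearMap.ker (L i) := by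
    rw [Submodule.span_le]
    intro m hm
    rw [SetLike.mem_coe, LinearMap.mem_ker]
    rcases hclosure m hm with rfl | ⟨j, hj, rfl⟩ | ⟨j, l, r, rfl⟩
    · exact h1 i
    · exact hne i j hj.symm
    · exact hmul i j l r
  have hmem : g i ∈ Algebra.adjoin k t := he ▸ Algebra.subset_adjoin (Set.mem_range_self i)
  rw [← Subalgebra.mem_toSubmodule, Algebra.adjoin_eq_span] at hmem
  have h0 := hle hmem
  rw [LinearMap.mem_ker, hg] at h0
  exact one_ne_zero h0

/-- Functionals on coordinates dual to the generators. -/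
def functCoords : Idx → Coords → F3
  | .inl i, z => functA i z.1
  | .inr (.inl i), z => functC i (z.2.1 0)
  | .inr (.inr (.inl i)), z => functD i (z.2.2.1 0)
  | .inr (.inr (.inr _)), z => cf 0 0 0 z.2.2.2

/-- Functionals dual to the generators. -/
def funct (i : Idx) : R →ₗ[F3] F3 where
  toFun r := functCoords i (coords r)
  map_add' r r' := by
    rw [map_add]
    rcases i with i | i | i | i <;> exact map_add _ _ _
  map_smul' c r := by
    rw [map_smul]
    rcases i with i | i | i | i
    exacts [map_smul (functA i) _ _, map_smul (functC i) _ _, map_smul (functD i) _ _,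
      map_smul (cf 0 0 0) _ _]

theorem funct_apply (i : Idx) (r : R) : funct i r = functCoords i (coords r) := rfl

theorem coords_incl (p : P) : coords (incl p) = (p, 0, 0, 0) := by
  rw [coords_apply, leftMul_incl]
  simp

theorem coords_oneForm (u : Fin 3 → P) : coords (oneForm u) = (0, u, 0, 0) := by
  rw [coords_apply, oneForm, leftMul_oneForm]
  simp

theorem coords_twoForm (u : Fin 3 → P) : coords (twoForm u) = (0, 0, u, 0) := by
  rw [coords_apply, twoForm, leftMul_twoForm]
  simp

theorem leftMul_yyy (z : Coords) : leftMul (y 0 * y 1 * y 2) z = (0, 0, 0, z.1) := by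
  have h := leftMul_threeForm 1 z
  rwa [map_one, one_mul, one_mul] at h

theorem coords_yyy : coords (y 0 * y 1 * y 2) = (0, 0, 0, 1) := leftMul_yyy _

theorem functCoords_smul_smul (i : Idx) (j k : Fin 4) (z : Coords) :
    functCoords i (polyA j • polyA k • z) = 0 := by
  rcases i with i | i | i | i
  · exact functA_polyA_mul i j k _
  · exact functC_polyA_mul i j _
  · exact functD_polyA_mul i j _
  · exact cf_zero_polyA_mul j _

theorem functCoords_smul (i : Idx) (j : Fin 4) (z : Coords) (hz : z.1 = 0) :
    functCoords i (polyA j • z) = 0 := by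
  rcases i with i | i | i | i
  · change functA i (polyA j * z.1) = 0
    rw [hz, mul_zero, map_zero]
  · exact functC_polyA_mul i j _
  · exact functD_polyA_mul i j _
  · exact cf_zero_polyA_mul j _

theorem functCoords_three (i : Idx) (p : P) (hp : cf 0 0 0 p = 0) :
    functCoords i (0, 0, 0, p) = 0 := by
  rcases i with i | i | i | i
  · exact map_zero _
  · exact map_zero _
  · exact map_zero _
  · exact hp

theorem functCoords_zero (i : Idx) : functCoords i 0 = 0 := by
  rcases i with i | i | i | i <;> exact map_zero _

theorem cf_zero_orbit_dot (j : Fin 6) (u : Fin 3 → P) : cf 0 0 0 (orbit (polyC j) ⬝ᵥ u) = 0 := by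
  rw [dotProduct, map_sum]
  exact Finset.sum_eq_zero fun l _ => cf_zero_orbit_mul j l _

theorem functCoords_wedge_wedge (i : Idx) (j k : Fin 6) (z : Coords) :
    functCoords i (wedge (orbit (polyC j)) (wedge (orbit (polyC k)) z)) = 0 := by
  rcases i with i | i | i | i
  · exact map_zero _
  · change functC i (((0 : P) • orbit (polyC j)) 0) = 0
    rw [zero_smul, Pi.zero_apply, map_zero]
  · change functD i ((orbit (polyC j) ⨯₃ (z.1 • orbit (polyC k))) 0) = 0
    rw [map_smul, Pi.smul_apply, smul_eq_mul, mul_comm, functD_cross]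
  · exact cf_zero_orbit_dot j _

theorem leftMul_gen_first (j : Fin 6 ⊕ Fin 3 ⊕ Unit) (z : Coords) :
    (leftMul (gen (.inr j)) z).1 = 0 := by
  rcases j with j | j | j
  · exact congrArg Prod.fst (leftMul_oneForm _ z)
  · exact congrArg Prod.fst (leftMul_twoForm _ z)
  · exact congrArg Prod.fst (leftMul_yyy z)

theorem leftMul_gen_inl (j : Fin 4) (z : Coords) : leftMul (gen (.inl j)) z = polyA j • z :=
  leftMul_incl _ z

/-- The cases follow the form degree: a polynomial factor is absorbed by the ideal lemmas, two
one-forms by `functD_cross`, and all remaining products vanish or are top forms without constant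
term in the coefficient. -/
theorem functCoords_gen_gen (i j k : Idx) (z : Coords) :
    functCoords i (leftMul (gen j) (leftMul (gen k) z)) = 0 := by
  rcases j with j | j
  · rw [leftMul_gen_inl]
    rcases k with k | k
    · rw [leftMul_gen_inl, functCoords_smul_smul]
    · exact functCoords_smul _ _ _ (leftMul_gen_first _ _)
  rcases k with k | k
  · rw [leftMul_gen_inl, map_smul]
    exact functCoords_smul _ _ _ (leftMul_gen_first _ _)
  have hC : ∀ j z, leftMul (gen (.inr (.inl j))) z = wedge (orbit (polyC j)) z :=
    fun j z => leftMul_oneForm _ z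
  have hD : ∀ j z, leftMul (gen (.inr (.inr (.inl j)))) z =
    (0, 0, z.1 • orbit (polyD j), orbit (polyD j) ⬝ᵥ z.2.1) := fun j z => leftMul_twoForm _ z
  have hY : ∀ j z, leftMul (gen (.inr (.inr (.inr j)))) z = (0, 0, 0, z.1) :=
    fun _ z => leftMul_yyy z
  rcases j with j | j | j <;> rcases k with k | k | k <;> simp only [hC, hD, hY]
  · exact functCoords_wedge_wedge i j k z
  · simp only [wedge_apply, zero_smul, map_zero]
    exact functCoords_three i _ (cf_zero_orbit_dot j _)
  · simp only [wedge_apply, zero_smul, map_zero, dotProduct_zero]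
    exact functCoords_zero i
  · simp only [wedge_apply, zero_smul]
    exact functCoords_three i _ (cf_zero_orbit_dot _ _)
  · simp only [zero_smul, dotProduct_zero]
    exact functCoords_zero i
  · simp only [zero_smul, dotProduct_zero]
    exact functCoords_zero i
  all_goals exact functCoords_zero i

theorem funct_gen_gen (i j k : Idx) (r : R) : funct i (gen j * (gen k * r)) = 0 := by
  rw [funct_apply, coords_mul, coords_mul, functCoords_gen_gen]

theorem funct_one (i : Idx) : funct i 1 = 0 := by
  have h : coords 1 = (1, 0, 0, 0) := by
    rw [← map_one incl, coords_incl]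
  rw [funct_apply, h]
  rcases i with i | i | i | i
  · change functA i 1 = 0
    fin_cases i <;> simp [functA, cf_one]
  all_goals exact map_zero _

theorem funct_gen (i j : Idx) : funct i (gen j) = if i = j then 1 else 0 := by
  have hA : ∀ j, coords (gen (.inl j)) = (polyA j, 0, 0, 0) := fun j => coords_incl _
  have hC : ∀ j, coords (gen (.inr (.inl j))) = (0, orbit (polyC j), 0, 0) :=
    fun j => coords_oneForm _
  have hD : ∀ j, coords (gen (.inr (.inr (.inl j)))) = (0, 0, orbit (polyD j), 0) :=
    fun j => coords_twoForm _
  have hY : ∀ j, coords (gen (.inr (.inr (.inr j)))) = (0, 0, 0, 1) := fun _ => coords_yyy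
  have h0 : ∀ p, orbit p 0 = p := fun p => rfl
  rcases i with i | i | i | i <;> rcases j with j | j | j | j <;>
    simp [funct_apply, functCoords, hA, hC, hD, hY, h0, functA_polyA, functC_polyC, functD_polyD,
      cf_one]

theorem gen_injective : Function.Injective gen := by
  intro i j h
  by_contra hij
  have h1 := funct_gen i j
  rw [← h, funct_gen, if_pos rfl, if_neg hij] at h1
  exact one_ne_zero h1

theorem ncard_generators : generators.ncard = 14 := by
  rw [← range_gen, Set.ncard_range_of_injective gen_injective]
  simp

theorem adjoin_ne_of_ssubset_generators (t : Set R) (ht : t ⊂ generators) :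
    Algebra.adjoin F3 t ≠ Algebra.adjoin F3 generators := by
  rw [← range_gen] at ht ⊢
  exact adjoin_ne_of_ssubset_range gen funct funct_one
    (fun i => by rw [funct_gen, if_pos rfl]) (fun i j h => by rw [funct_gen, if_neg h])
    funct_gen_gen t ht

/-! ### The three relations -/

theorem oneForm_mul_oneForm (u u' : Fin 3 → P) : oneForm u * oneForm u' = twoForm (u ⨯₃ u') := by
  apply coords_injective
  rw [coords_mul, coords_oneForm, oneForm, leftMul_oneForm, coords_twoForm]
  simp

theorem incl_mul_twoForm (p : P) (u : Fin 3 → P) : incl p * twoForm u = twoForm (p • u) := by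
  simp only [twoForm, mul_add, Pi.smul_apply, smul_eq_mul, map_mul, mul_assoc]

theorem twoForm_add (u u' : Fin 3 → P) : twoForm (u + u') = twoForm u + twoForm u' := by
  simp only [twoForm, Pi.add_apply, map_add, add_mul]
  abel

theorem twoForm_neg (u : Fin 3 → P) : twoForm (-u) = -twoForm u := by
  have h0 : twoForm 0 = 0 := by simp only [twoForm, Pi.zero_apply, map_zero, zero_mul, add_zero]
  rw [eq_neg_iff_add_eq_zero, ← twoForm_add, neg_add_cancel, h0]

theorem twoForm_sub (u u' : Fin 3 → P) : twoForm (u - u') = twoForm u - twoForm u' := by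
  rw [sub_eq_add_neg, twoForm_add, twoForm_neg, sub_eq_add_neg]

theorem three_eq_zero : (3 : P) = 0 := by
  exact_mod_cast CharP.cast_eq_zero P 3

/-- A product of one-forms is the cross product of coefficient vectors, so the relation is a vector
identity in P that holds modulo 3. -/
theorem c1_mul_c2 : c1 * c2 = -d4 - a1 * d1 + d3 := by
  have hc := congrFun oneForm_polyC
  have hd := congrFun twoForm_polyC
  have h : orbit (polyC 0) ⨯₃ orbit (polyC 1) =
      -orbit (polyC 3) - polyA 0 • orbit (polyC 0) + orbit (polyC 2) := by
    ext1 i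
    fin_cases i <;> simp [orbit, polyC, polyA, cross_apply, cyc_X0, cyc_X1, cyc_X2]
    · linear_combination (X 0 * X 1 ^ 2) * three_eq_zero
    · linear_combination (X 1 * X 2 ^ 2) * three_eq_zero
    · linear_combination (X 2 * X 0 ^ 2) * three_eq_zero
  rw [show c1 = _ from (hc 0).symm, show c2 = _ from (hc 1).symm, show d4 = _ from (hd 3).symm,
    show d1 = _ from (hd 0).symm, show d3 = _ from (hd 2).symm, ← incl_polyA_zero,
    oneForm_mul_oneForm, incl_mul_twoForm, h, twoForm_add, twoForm_sub, twoForm_neg]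

theorem c1_mul_c3 : c1 * c3 = a1 * d2 + d5 - a2 * d1 := by
  have hc := congrFun oneForm_polyC
  have hd := congrFun twoForm_polyC
  have h : orbit (polyC 0) ⨯₃ orbit (polyC 2) =
      polyA 0 • orbit (polyC 1) + orbit (polyC 4) - polyA 1 • orbit (polyC 0) := by
    ext1 i
    fin_cases i <;> simp [orbit, polyC, polyA, cross_apply, cyc_X0, cyc_X1, cyc_X2]
    · linear_combination (-(X 1 ^ 3 * X 2)) * three_eq_zero
    · linear_combination (-(X 2 ^ 3 * X 0)) * three_eq_zero
    · linear_combination (-(X 0 ^ 3 * X 1)) * three_eq_zero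
  rw [show c1 = _ from (hc 0).symm, show c3 = _ from (hc 2).symm, show d5 = _ from (hd 4).symm,
    show d1 = _ from (hd 0).symm, show d2 = _ from (hd 1).symm, ← incl_polyA_zero,
    ← incl_polyA_one, oneForm_mul_oneForm, incl_mul_twoForm, incl_mul_twoForm, h, twoForm_sub,
    twoForm_add]

theorem c2_mul_c3 :
    c2 * c3 = -d6 + a1 * d4 - a1 * d3 + a2 * d2 - a3 * d1 - a1 ^ 2 * d1 := by
  have hc := congrFun oneForm_polyC
  have hd := congrFun twoForm_polyC
  have h : orbit (polyC 1) ⨯₃ orbit (polyC 2) =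
      -orbit (polyC 5) + polyA 0 • orbit (polyC 3) - polyA 0 • orbit (polyC 2) +
        polyA 1 • orbit (polyC 1) - polyA 2 • orbit (polyC 0) - polyA 0 ^ 2 • orbit (polyC 0) := by
    ext1 i
    fin_cases i <;> simp [orbit, polyC, polyA, cross_apply, cyc_X0, cyc_X1, cyc_X2]
    · linear_combination (X 0 * X 2 ^ 4 + X 0 ^ 5 + X 0 ^ 3 * X 1 ^ 2 + X 0 ^ 3 * X 2 ^ 2) *
        three_eq_zero
    · linear_combination (X 1 * X 0 ^ 4 + X 1 ^ 5 + X 1 ^ 3 * X 2 ^ 2 + X 1 ^ 3 * X 0 ^ 2) *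
        three_eq_zero
    · linear_combination (X 2 * X 1 ^ 4 + X 2 ^ 5 + X 2 ^ 3 * X 0 ^ 2 + X 2 ^ 3 * X 1 ^ 2) *
        three_eq_zero
  rw [show c2 = _ from (hc 1).symm, show c3 = _ from (hc 2).symm, show d1 = _ from (hd 0).symm,
    show d2 = _ from (hd 1).symm, show d3 = _ from (hd 2).symm, show d4 = _ from (hd 3).symm,
    show d6 = _ from (hd 5).symm, ← incl_polyA_zero, ← incl_polyA_one, ← incl_polyA_two,
    ← map_pow]
  simp only [oneForm_mul_oneForm, incl_mul_twoForm]
  rw [h, twoForm_sub, twoForm_sub, twoForm_add, twoForm_sub, twoForm_add, twoForm_neg]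

/-! ### Spanning over symmetric polynomials in the squares -/

/-- A polynomial ring in three variables is spanned over its symmetric polynomials by six
monomials. -/
theorem mul_monomial_mem {K : Type*} [CommRing K] (W : AddSubgroup K) (A B C m : K)
    (h1 : ∀ f ∈ W, (A + B + C) * f ∈ W) (h2 : ∀ f ∈ W, (A * B + A * C + B * C) * f ∈ W)
    (h3 : ∀ f ∈ W, A * B * C * f ∈ W) (m00 : m ∈ W) (m10 : m * A ∈ W) (m20 : m * A ^ 2 ∈ W)
    (m01 : m * B ∈ W) (m11 : m * (A * B) ∈ W) (m21 : m * (A ^ 2 * B) ∈ W) (i j k : ℕ) :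
    m * (A ^ i * B ^ j * C ^ k) ∈ W := by
  -- A is a root of T³ - e₁T² + e₂T - e₃, so powers from A³ on reduce.
  have step1 : ∀ n, n ∈ W → n * A ∈ W → n * A ^ 2 ∈ W → ∀ i, n * A ^ i ∈ W := by
    intro n n0 n1 n2 i
    suffices h : n * A ^ i ∈ W ∧ n * A ^ (i + 1) ∈ W ∧ n * A ^ (i + 2) ∈ W from h.1
    induction i with
    | zero => exact ⟨by simpa using n0, by simpa using n1, by simpa using n2⟩
    | succ i ih =>
      obtain ⟨ha, hb, hc⟩ := ih
      refine ⟨hb, hc, ?_⟩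
      have e : n * A ^ (i + 1 + 2) = (A + B + C) * (n * A ^ (i + 2)) -
          (A * B + A * C + B * C) * (n * A ^ (i + 1)) + A * B * C * (n * A ^ i) := by ring
      rw [e]
      exact add_mem (sub_mem (h1 _ hc) (h2 _ hb)) (h3 _ ha)
  have step2 : ∀ j i, m * (A ^ i * B ^ j) ∈ W := by
    intro j
    suffices h : (∀ i, m * (A ^ i * B ^ j) ∈ W) ∧ ∀ i, m * (A ^ i * B ^ (j + 1)) ∈ W from h.1
    induction j with
    | zero =>
      refine ⟨fun i => ?_, fun i => ?_⟩
      · simpa using step1 m m00 m10 m20 i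
      · have h := step1 (m * B) m01 (by convert m11 using 1; ring) (by convert m21 using 1; ring) i
        convert h using 1
        ring
    | succ j ih =>
      obtain ⟨ha, hb⟩ := ih
      refine ⟨hb, fun i => ?_⟩
      -- From C = e₁ - A - B one gets B² = e₁A + e₁B - e₂ - A² - AB.
      have e : m * (A ^ i * B ^ (j + 1 + 1)) = (A + B + C) * (m * (A ^ (i + 1) * B ^ j)) +
          (A + B + C) * (m * (A ^ i * B ^ (j + 1))) -
          (A * B + A * C + B * C) * (m * (A ^ i * B ^ j)) - m * (A ^ (i + 2) * B ^ j) -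
          m * (A ^ (i + 1) * B ^ (j + 1)) := by ring
      rw [e]
      exact sub_mem (sub_mem (sub_mem (add_mem (h1 _ (ha _)) (h1 _ (hb _))) (h2 _ (ha _))) (ha _))
        (hb _)
  induction k generalizing i j with
  | zero => simpa using step2 j i
  | succ k ih =>
    have e : m * (A ^ i * B ^ j * C ^ (k + 1)) = (A + B + C) * (m * (A ^ i * B ^ j * C ^ k)) -
        m * (A ^ (i + 1) * B ^ j * C ^ k) - m * (A ^ i * B ^ (j + 1) * C ^ k) := by ring
    rw [e]
    exact sub_mem (sub_mem (h1 _ (ih _ _)) (ih _ _)) (ih _ _)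

/-- Stability of a subgroup of `P` under multiplication by `a₁, a₂, a₃`. -/
def IsStable (W : AddSubgroup P) : Prop := ∀ j ∈ ({0, 1, 2} : Set (Fin 4)), ∀ f ∈ W, polyA j * f ∈ W

section Stable

variable {W : AddSubgroup P} (hW : IsStable W)

include hW

theorem IsStable.zero {f : P} (hf : f ∈ W) : (X 0 ^ 2 + X 1 ^ 2 + X 2 ^ 2) * f ∈ W :=
  hW 0 (by simp) f hf

theorem IsStable.one {f : P} (hf : f ∈ W) : X 0 * X 1 * X 2 * f ∈ W := hW 1 (by simp) f hf

theorem IsStable.two {f : P} (hf : f ∈ W) : (X 0 ^ 4 + X 1 ^ 4 + X 2 ^ 4) * f ∈ W :=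
  hW 2 (by simp) f hf

/-- In the squares, a₁² = a₃ + 2e₂, and -2 = 1 gives e₂ = a₃ - a₁². -/
theorem IsStable.elemSymm {f : P} (hf : f ∈ W) :
    (X 0 ^ 2 * X 1 ^ 2 + X 0 ^ 2 * X 2 ^ 2 + X 1 ^ 2 * X 2 ^ 2) * f ∈ W := by
  have e : (X 0 ^ 2 * X 1 ^ 2 + X 0 ^ 2 * X 2 ^ 2 + X 1 ^ 2 * X 2 ^ 2) * f =
      (X 0 ^ 4 + X 1 ^ 4 + X 2 ^ 4) * f -
        (X 0 ^ 2 + X 1 ^ 2 + X 2 ^ 2) * ((X 0 ^ 2 + X 1 ^ 2 + X 2 ^ 2) * f) := by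
    linear_combination
      ((X 0 ^ 2 * X 1 ^ 2 + X 0 ^ 2 * X 2 ^ 2 + X 1 ^ 2 * X 2 ^ 2) * f) * three_eq_zero
  rw [e]
  exact sub_mem (hW.two hf) (hW.zero (hW.zero hf))

theorem IsStable.mul_mem {m : P} (m00 : m ∈ W) (m10 : m * X 0 ^ 2 ∈ W) (m20 : m * X 0 ^ 4 ∈ W)
    (m01 : m * X 1 ^ 2 ∈ W) (m11 : m * (X 0 ^ 2 * X 1 ^ 2) ∈ W)
    (m21 : m * (X 0 ^ 4 * X 1 ^ 2) ∈ W) (i j k : ℕ) :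
    m * ((X 0 ^ 2) ^ i * (X 1 ^ 2) ^ j * (X 2 ^ 2) ^ k) ∈ W := by
  refine mul_monomial_mem W _ _ _ m (fun f => hW.zero) (fun f => hW.elemSymm) (fun f hf => ?_)
    m00 m10 ?_ m01 m11 ?_ i j k
  · have e : (X 0 ^ 2 * X 1 ^ 2 * X 2 ^ 2) * f = X 0 * X 1 * X 2 * (X 0 * X 1 * X 2 * f) := by
      ring
    rw [e]
    exact hW.one (hW.one hf)
  · rw [← pow_mul]
    exact m20
  · rw [← pow_mul]
    exact m21

/-- The polynomials `x₁ p + x₂x₃ q`, with `p` and `q` polynomials in the squares, form the smallest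
stable subgroup that contains the first coefficients of `c₁, …, c₆`. -/
theorem IsStable.semiinvariant_mem (hC : ∀ j, polyC j ∈ W) (i j k : ℕ) :
    X 0 * ((X 0 ^ 2) ^ i * (X 1 ^ 2) ^ j * (X 2 ^ 2) ^ k) ∈ W ∧
    X 1 * X 2 * ((X 0 ^ 2) ^ i * (X 1 ^ 2) ^ j * (X 2 ^ 2) ^ k) ∈ W := by
  have s1 : X 0 ∈ W := hC 0
  have s2 : X 1 * X 2 ∈ W := hC 1
  have s3 : X 0 ^ 3 ∈ W := hC 2
  have s4 : X 0 * X 1 ^ 2 ∈ W := hC 3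
  have s5 : X 1 ^ 3 * X 2 ∈ W := hC 4
  have s6 : X 0 ^ 3 * X 1 ^ 2 ∈ W := hC 5
  constructor
  · refine hW.mul_mem s1 ?_ ?_ s4 ?_ ?_ i j k
    · convert s3 using 1
      ring
    -- A² = e₁A - e₂ + BC, and x₁BC = a₂ · x₂x₃; the case of A²B below is this identity times B.
    · convert add_mem (sub_mem (hW.one s2) (hW.elemSymm s1)) (hW.zero s3) using 1
      ring
    · convert s6 using 1
      ring
    · convert add_mem (sub_mem (hW.one s5) (hW.elemSymm s4)) (hW.zero s6) using 1
      ring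
  -- Since x₂x₃A = a₂x₁, monomials containing A come from the x₁ family; only x₂x₃ and x₂x₃B are
  -- new.
  · refine hW.mul_mem s2 ?_ ?_ ?_ ?_ ?_ i j k
    · convert hW.one s1 using 1
      ring
    · convert hW.one s3 using 1
      ring
    · convert s5 using 1
      ring
    · convert hW.one s4 using 1
      ring
    · convert hW.one s6 using 1
      ring

end Stable

/-! ### Parity of exponents, cyclic traces and invariant polynomials -/

theorem monomial_eq_mul (α : Fin 3 →₀ ℕ) (r : F3) :
    monomial α r = r • (X 0 ^ α 0 * X 1 ^ α 1 * X 2 ^ α 2) := by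
  rw [monomial_eq, Finsupp.prod_fintype _ _ fun _ => pow_zero _, Fin.prod_univ_three, smul_eq_C_mul]

theorem sgn_monomial (α : Fin 3 →₀ ℕ) (r : F3) :
    sgn (monomial α r) = (-1 : F3) ^ (α 1 + α 2) • monomial α r := by
  have h0 : sgn (X 0) = X 0 := by rw [sgn_X]; exact one_smul _ _
  have h1 : sgn (X 1) = (-1 : F3) • X 1 := sgn_X 1
  have h2 : sgn (X 2) = (-1 : F3) • X 2 := sgn_X 2
  rw [monomial_eq_mul, map_smul, map_mul, map_mul, map_pow, map_pow, map_pow, h0, h1, h2, smul_pow,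
    smul_pow, pow_add, smul_comm _ r]
  simp only [mul_smul_comm, smul_smul, mul_comm]

theorem coeff_sgn (α : Fin 3 →₀ ℕ) (p : P) :
    coeff α (sgn p) = (-1) ^ (α 1 + α 2) * coeff α p := by
  induction p using MvPolynomial.induction_on' with
  | monomial β r =>
    rw [sgn_monomial, coeff_smul, coeff_monomial, smul_eq_mul]
    split_ifs with h
    · rw [h]
    · rw [mul_zero, mul_zero]
  | add p q hp hq => rw [map_add, coeff_add, coeff_add, hp, hq, mul_add]

/-- The rotation of exponents. -/
def rot (α : Fin 3 →₀ ℕ) : Fin 3 →₀ ℕ := α.mapDomain (· + 1)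

theorem rot_succ (α : Fin 3 →₀ ℕ) (i : Fin 3) : rot α (i + 1) = α i :=
  Finsupp.mapDomain_apply (add_left_injective 1) α i

theorem rot_zero (α : Fin 3 →₀ ℕ) : rot α 0 = α 2 := rot_succ α 2

theorem rot_one (α : Fin 3 →₀ ℕ) : rot α 1 = α 0 := rot_succ α 0

theorem rot_two (α : Fin 3 →₀ ℕ) : rot α 2 = α 1 := rot_succ α 1

theorem rot_rot_rot (α : Fin 3 →₀ ℕ) : rot (rot (rot α)) = α := by
  ext i
  fin_cases i <;> simp [rot_zero, rot_one, rot_two]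

theorem coeff_rot_cyc (α : Fin 3 →₀ ℕ) (p : P) : coeff (rot α) (cyc p) = coeff α p :=
  coeff_rename_mapDomain _ (add_left_injective 1) p α

theorem even_of_sgn_eq {p : P} (h : sgn p = p) {α : Fin 3 →₀ ℕ} (hα : coeff α p ≠ 0) :
    Even (α 1 + α 2) := by
  by_contra ho
  have h1 := coeff_sgn α p
  rw [h, (Nat.not_even_iff_odd.1 ho).neg_one_pow] at h1
  exact hα ((by decide : ∀ r : F3, r = -1 * r → r = 0) _ h1)

theorem odd_of_sgn_eq {p : P} (h : sgn p = -p) {α : Fin 3 →₀ ℕ} (hα : coeff α p ≠ 0) :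
    ¬ Even (α 1 + α 2) := by
  intro he
  have h1 := coeff_sgn α p
  rw [h, he.neg_one_pow, coeff_neg] at h1
  exact hα ((by decide : ∀ r : F3, -r = 1 * r → r = 0) _ h1)

/-- The part of a polynomial that is supported on a set of exponents. -/
def part (D : (Fin 3 →₀ ℕ) → Prop) [DecidablePred D] (p : P) : P :=
  ∑ α ∈ p.support with D α, monomial α (coeff α p)

theorem coeff_part (D : (Fin 3 →₀ ℕ) → Prop) [DecidablePred D] (p : P) (β : Fin 3 →₀ ℕ) :
    coeff β (part D p) = if D β then coeff β p else 0 := by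
  rw [part, coeff_sum]
  simp only [coeff_monomial, Finset.sum_ite_eq', Finset.mem_filter, mem_support_iff]
  split_ifs with h1 h2 h2
  · rfl
  · exact absurd h1.2 h2
  · by_contra h
    exact h1 ⟨fun h0 => h h0.symm, h2⟩
  · rfl

/-- The sum over the orbit of the cyclic permutation. -/
def cycTrace : P →ₗ[F3] P where
  toFun f := f + cyc f + cyc (cyc f)
  map_add' f g := by
    simp only [map_add]
    ring
  map_smul' r f := by simp

theorem cycTrace_apply (f : P) : cycTrace f = f + cyc f + cyc (cyc f) := rfl

theorem cycTrace_mul {a : P} (ha : cyc a = a) (f : P) : cycTrace (a * f) = a * cycTrace f := by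
  simp only [cycTrace_apply, map_mul, ha]
  ring

/-- A cyclically invariant polynomial is a sum over orbits up to terms `(x₁x₂x₃)ᵏ`. -/
theorem eq_part_add_cycTrace {p : P} (hp : cyc p = p) :
    p = part (fun α => α 0 = α 1 ∧ α 1 = α 2) p +
      cycTrace (part (fun α => α 0 < α 1 ∧ α 0 ≤ α 2) p) := by
  have hrot : ∀ β, coeff (rot β) p = coeff β p := fun β => by
    conv_lhs => rw [← hp]
    exact coeff_rot_cyc β p
  have hc1 : ∀ (q : P) β, coeff β (cyc q) = coeff (rot (rot β)) q := fun q β => by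
    conv_lhs => rw [← rot_rot_rot β]
    exact coeff_rot_cyc _ q
  -- The condition α₀ < α₁, α₀ ≤ α₂ selects exactly one exponent vector in each rotation orbit of
  -- size three, also when the minimum is attained twice.
  ext β
  rw [cycTrace_apply, coeff_add, coeff_add, coeff_add, hc1, hc1, hc1, rot_rot_rot, coeff_part,
    coeff_part, coeff_part, coeff_part, hrot, hrot]
  simp only [rot_zero, rot_one, rot_two]
  split_ifs <;> first | omega | simp

theorem part_mem (W : Submodule F3 P) (D : (Fin 3 →₀ ℕ) → Prop) [DecidablePred D] (p : P)
    (h : ∀ α, coeff α p ≠ 0 → D α → X 0 ^ α 0 * X 1 ^ α 1 * X 2 ^ α 2 ∈ W) : part D p ∈ W := by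
  refine sum_mem fun α hα => ?_
  rw [Finset.mem_filter, mem_support_iff] at hα
  rw [monomial_eq_mul]
  exact W.smul_mem _ (h α hα.1 hα.2)

theorem cyc_polyA (j : Fin 4) : cyc (polyA j) = polyA j := by
  fin_cases j <;> simp [polyA, cyc_X0, cyc_X1, cyc_X2] <;> ring

/-- The trace is linear over cyclic invariants, so the preimage of S is stable and six monomials
suffice. Their traces are 0, a₁, a₃, a₁, e₂ and b. -/
theorem cycTrace_mem {S : Submodule F3 P} (hS : IsStable S.toAddSubgroup)
    (h1 : 1 ∈ S) (hb : polyA 3 ∈ S) (i j k : ℕ) :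
    cycTrace ((X 0 ^ 2) ^ i * (X 1 ^ 2) ^ j * (X 2 ^ 2) ^ k) ∈ S := by
  have hW : IsStable (S.comap cycTrace).toAddSubgroup := by
    intro l hl f hf
    change cycTrace (polyA l * f) ∈ S
    rw [cycTrace_mul (cyc_polyA l)]
    exact hS l hl _ hf
  have m1 : (X 0 ^ 2 + X 1 ^ 2 + X 2 ^ 2) * 1 ∈ S := hS.zero h1
  have h := hW.mul_mem (m := 1) ?_ ?_ ?_ ?_ ?_ ?_ i j k
  · rw [one_mul] at h
    exact h
  · change cycTrace 1 ∈ S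
    -- The trace of 1 is 3 = 0, which is why constants have to enter separately through `h1`.
    have e : cycTrace 1 = 0 := by
      rw [cycTrace_apply, map_one, map_one]
      linear_combination three_eq_zero
    rw [e]
    exact zero_mem S
  · change cycTrace _ ∈ S
    convert m1 using 1
    simp [cycTrace_apply, cyc_X0, cyc_X1]
  · change cycTrace _ ∈ S
    have m2 : _ ∈ S := hS.two h1
    convert m2 using 1
    simp [cycTrace_apply, cyc_X0, cyc_X1]
  · change cycTrace _ ∈ S
    convert m1 using 1
    simp [cycTrace_apply, cyc_X1, cyc_X2]
    ring
  · change cycTrace _ ∈ S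
    have m2 : _ ∈ S := hS.elemSymm h1
    convert m2 using 1
    simp [cycTrace_apply, cyc_X0, cyc_X1, cyc_X2]
    ring
  · change cycTrace _ ∈ S
    convert hb using 1
    simp [cycTrace_apply, polyA, cyc_X0, cyc_X1, cyc_X2]
    ring

/-- An invariant polynomial lies in every stable subspace that contains `1` and `b`. -/
theorem invariant_mem {S : Submodule F3 P} (hS : IsStable S.toAddSubgroup)
    (h1 : 1 ∈ S) (hb : polyA 3 ∈ S) {p : P} (hs : sgn p = p) (hc : cyc p = p) : p ∈ S := by
  -- Sign invariance is applied to α and to its rotation, so all three exponents have the same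
  -- parity.
  have hparity : ∀ α, coeff α p ≠ 0 → Even (α 1 + α 2) ∧ Even (α 0 + α 1) := by
    intro α hα
    refine ⟨even_of_sgn_eq hs hα, ?_⟩
    rw [← rot_one α, ← rot_two α]
    refine even_of_sgn_eq hs ?_
    rwa [← hc, coeff_rot_cyc]
  rw [eq_part_add_cycTrace hc]
  refine add_mem (part_mem S _ p fun α _ hα => ?_) (part_mem (S.comap cycTrace) _ p fun α hα _ => ?_)
  · rw [← hα.2, ← hα.1, ← mul_pow, ← mul_pow]
    induction α 0 with
    | zero => rwa [pow_zero]
    | succ n ih =>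
      rw [pow_succ']
      exact hS.one ih
  · rw [Submodule.mem_comap]
    obtain ⟨h12, h01⟩ := hparity α hα
    rw [Nat.even_add] at h12 h01
    by_cases h0 : Even (α 0)
    · obtain ⟨i, hi⟩ := h0.exists_two_nsmul
      obtain ⟨j, hj⟩ := (h01.1 h0).exists_two_nsmul
      obtain ⟨k, hk⟩ := (h12.1 (h01.1 h0)).exists_two_nsmul
      rw [hi, hj, hk, smul_eq_mul, smul_eq_mul, smul_eq_mul, pow_mul, pow_mul, pow_mul]
      exact cycTrace_mem hS h1 hb i j k
    · obtain ⟨i, hi⟩ := Nat.not_even_iff_odd.1 h0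
      obtain ⟨j, hj⟩ := Nat.not_even_iff_odd.1 fun h => h0 (h01.2 h)
      obtain ⟨k, hk⟩ := Nat.not_even_iff_odd.1 fun h => h0 (h01.2 (h12.2 h))
      -- Three odd exponents allow one factor a₂ to be split off, leaving a monomial in the squares.
      have e : (X 0 ^ α 0 * X 1 ^ α 1 * X 2 ^ α 2 : P) =
          polyA 1 * ((X 0 ^ 2) ^ i * (X 1 ^ 2) ^ j * (X 2 ^ 2) ^ k) := by
        rw [hi, hj, hk]
        simp only [polyA, cons_val]
        ring
      rw [e, cycTrace_mul (cyc_polyA 1)]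
      exact hS 1 (by simp) _ (cycTrace_mem hS h1 hb i j k)

theorem part_true (p : P) : part (fun _ => True) p = p := by
  ext β
  rw [coeff_part, if_pos trivial]

/-- The first coefficient of an invariant form lies in every stable subspace that contains the
first coefficients of `c₁, …, c₆`. -/
theorem semiinvariant_mem {S : Submodule F3 P} (hS : IsStable S.toAddSubgroup)
    (hC : ∀ j, polyC j ∈ S) {f : P} (h0 : sgn f = f) (h1 : sgn (cyc f) = -cyc f) : f ∈ S := by
  rw [← part_true f]
  refine part_mem S _ f fun α hα _ => ?_
  have h12 := even_of_sgn_eq h0 hα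
  have h01 : ¬ Even (α 0 + α 1) := by
    rw [← rot_one α, ← rot_two α]
    refine odd_of_sgn_eq h1 ?_
    rwa [coeff_rot_cyc]
  rw [Nat.even_add] at h12 h01
  -- The last two exponents share a parity opposite to that of the first: the monomial is x₂x₃ or x₁
  -- times a monomial in the squares.
  by_cases ho : Even (α 0)
  · have ho1 : ¬ Even (α 1) := fun h => h01 ⟨fun _ => h, fun _ => ho⟩
    obtain ⟨i, hi⟩ := ho.exists_two_nsmul
    obtain ⟨j, hj⟩ := Nat.not_even_iff_odd.1 ho1
    obtain ⟨k, hk⟩ := Nat.not_even_iff_odd.1 fun h => ho1 (h12.2 h)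
    have h : _ ∈ S := (IsStable.semiinvariant_mem hS hC i j k).2
    convert h using 1
    rw [hi, hj, hk, smul_eq_mul]
    ring
  · have he1 : Even (α 1) := by tauto
    obtain ⟨i, hi⟩ := Nat.not_even_iff_odd.1 ho
    obtain ⟨j, hj⟩ := he1.exists_two_nsmul
    obtain ⟨k, hk⟩ := (h12.1 he1).exists_two_nsmul
    have h : _ ∈ S := (IsStable.semiinvariant_mem hS hC i j k).1
    convert h using 1
    rw [hi, hj, hk, smul_eq_mul, smul_eq_mul]
    ring

/-! ### Generation of the invariant algebra -/

theorem cyc_cyc_cyc (f : P) : cyc (cyc (cyc f)) = f := by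
  ext β
  rw [← rot_rot_rot β, coeff_rot_cyc, coeff_rot_cyc, coeff_rot_cyc, rot_rot_rot]

theorem eq_orbit {u : Fin 3 → P} (h : ∀ i, u (i + 1) = cyc (u i)) : u = orbit (u 0) := by
  ext1 i
  fin_cases i
  exacts [rfl, h 0, (h 1).trans (congrArg cyc (h 0))]

theorem orbit_mul {a : P} (ha : cyc a = a) (f : P) : orbit (a * f) = a • orbit f := by
  ext1 i
  fin_cases i <;> simp [orbit, ha]

theorem incl_mul_oneForm (p : P) (u : Fin 3 → P) : incl p * oneForm u = oneForm (p • u) := by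
  simp only [oneForm, mul_add, Pi.smul_apply, smul_eq_mul, map_mul, mul_assoc]

/-- The cyclically invariant one-form with a given first coefficient. -/
def orbitOne : P →ₗ[F3] R where
  toFun f := oneForm (orbit f)
  map_add' f g := by
    simp only [oneForm_orbit, map_add, add_mul]
    abel
  map_smul' r f := by
    rw [Algebra.smul_def, orbit_mul (AlgHom.commutes cyc r), ← incl_mul_oneForm, AlgHom.commutes,
      ← Algebra.smul_def, RingHom.id_apply]

/-- The cyclically invariant two-form with a given first coefficient. -/
def orbitTwo : P →ₗ[F3] R where
  toFun f := twoForm (orbit f)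
  map_add' f g := by
    simp only [twoForm_orbit, map_add, add_mul]
    abel
  map_smul' r f := by
    rw [Algebra.smul_def, orbit_mul (AlgHom.commutes cyc r), ← incl_mul_twoForm, AlgHom.commutes,
      ← Algebra.smul_def, RingHom.id_apply]

theorem gen_mem (i : Idx) : gen i ∈ Algebra.adjoin F3 generators := by
  rw [← range_gen]
  exact Algebra.subset_adjoin (Set.mem_range_self i)

/-- The polynomials whose image under a linear map lies in the algebra generated by the
generators. -/
def goodPart (θ : P →ₗ[F3] R) : Submodule F3 P :=
  (Subalgebra.toSubmodule (Algebra.adjoin F3 generators)).comap θ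

theorem mem_goodPart (θ : P →ₗ[F3] R) (f : P) :
    f ∈ goodPart θ ↔ θ f ∈ Algebra.adjoin F3 generators := Iff.rfl

/-- This turns membership in the generated algebra into a stable-subspace question in P, for each
form degree at once. -/
theorem isStable_goodPart (θ : P →ₗ[F3] R) (h : ∀ j f, θ (polyA j * f) = incl (polyA j) * θ f) :
    IsStable (goodPart θ).toAddSubgroup := by
  intro j _ f hf
  change θ (polyA j * f) ∈ Algebra.adjoin F3 generators
  rw [h]
  exact mul_mem (gen_mem (.inl j)) hf

theorem incl_mem {p : P} (hs : sgn p = p) (hc : cyc p = p) :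
    incl p ∈ Algebra.adjoin F3 generators := by
  refine invariant_mem (S := goodPart incl.toLinearMap) (isStable_goodPart _ fun j f => ?_) ?_ ?_
    hs hc
  · exact map_mul incl _ _
  · rw [mem_goodPart]
    change incl 1 ∈ _
    rw [map_one]
    exact one_mem _
  · exact gen_mem (.inl 3)

theorem c_mem (j : Fin 6) : oneForm (orbit (polyC j)) ∈ Algebra.adjoin F3 generators :=
  gen_mem (.inr (.inl j))

/-- The relations are solved for d₄, d₅, d₆; d₄ has to precede d₆, whose relation contains a₁d₄. -/
theorem d_mem (j : Fin 6) : twoForm (orbit (polyC j)) ∈ Algebra.adjoin F3 generators := by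
  have hc := congrFun oneForm_polyC
  have hd := congrFun twoForm_polyC
  have ma1 : a1 ∈ Algebra.adjoin F3 generators := incl_polyA_zero ▸ gen_mem (.inl 0)
  have ma2 : a2 ∈ Algebra.adjoin F3 generators := incl_polyA_one ▸ gen_mem (.inl 1)
  have ma3 : a3 ∈ Algebra.adjoin F3 generators := incl_polyA_two ▸ gen_mem (.inl 2)
  have mc : ∀ j, ![c1, c2, c3, c4, c5, c6] j ∈ Algebra.adjoin F3 generators := fun j => by
    rw [← hc]
    exact c_mem j
  have md : ∀ j : Fin 3, ![d1, d2, d3, d4, d5, d6] (j.castLE (by decide)) ∈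
      Algebra.adjoin F3 generators := fun j => by
    rw [← hd]
    exact gen_mem (.inr (.inr (.inl j)))
  have mc1 : c1 ∈ Algebra.adjoin F3 generators := mc 0
  have mc2 : c2 ∈ Algebra.adjoin F3 generators := mc 1
  have mc3 : c3 ∈ Algebra.adjoin F3 generators := mc 2
  have md1 : d1 ∈ Algebra.adjoin F3 generators := md 0
  have md2 : d2 ∈ Algebra.adjoin F3 generators := md 1
  have md3 : d3 ∈ Algebra.adjoin F3 generators := md 2
  have md4 : d4 ∈ Algebra.adjoin F3 generators := by
    have e : d4 = d3 - a1 * d1 - c1 * c2 := by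
      rw [c1_mul_c2]
      abel
    rw [e]
    exact sub_mem (sub_mem md3 (mul_mem ma1 md1)) (mul_mem mc1 mc2)
  have md5 : d5 ∈ Algebra.adjoin F3 generators := by
    have e : d5 = c1 * c3 - a1 * d2 + a2 * d1 := by
      rw [c1_mul_c3]
      abel
    rw [e]
    exact add_mem (sub_mem (mul_mem mc1 mc3) (mul_mem ma1 md2)) (mul_mem ma2 md1)
  have md6 : d6 ∈ Algebra.adjoin F3 generators := by
    have e : d6 = a1 * d4 - a1 * d3 + a2 * d2 - a3 * d1 - a1 ^ 2 * d1 - c2 * c3 := by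
      rw [c2_mul_c3]
      abel
    rw [e]
    exact sub_mem (sub_mem (sub_mem (add_mem (sub_mem (mul_mem ma1 md4) (mul_mem ma1 md3))
      (mul_mem ma2 md2)) (mul_mem ma3 md1)) (mul_mem (pow_mem ma1 2) md1)) (mul_mem mc2 mc3)
  rw [hd]
  fin_cases j
  exacts [md1, md2, md3, md4, md5, md6]

theorem oneForm_mem {u : Fin 3 → P} (hs : ∀ i, sgn (u i) = sign i • u i)
    (hc : ∀ i, u (i + 1) = cyc (u i)) : oneForm u ∈ Algebra.adjoin F3 generators := by
  rw [eq_orbit hc]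
  have h1 := hs 1
  rw [show u 1 = cyc (u 0) from hc 0, show sign 1 = -1 from rfl, neg_one_smul] at h1
  have h0 : sgn (u 0) = u 0 := (hs 0).trans (one_smul _ _)
  refine semiinvariant_mem (S := goodPart orbitOne) (isStable_goodPart _ fun j f => ?_) c_mem h0 h1
  change oneForm (orbit (polyA j * f)) = incl (polyA j) * oneForm (orbit f)
  rw [incl_mul_oneForm, orbit_mul (cyc_polyA j)]

theorem twoForm_mem {u : Fin 3 → P} (hs : ∀ i, sgn (u i) = sign i • u i)
    (hc : ∀ i, u (i + 1) = cyc (u i)) : twoForm u ∈ Algebra.adjoin F3 generators := by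
  rw [eq_orbit hc]
  have h1 := hs 1
  rw [show u 1 = cyc (u 0) from hc 0, show sign 1 = -1 from rfl, neg_one_smul] at h1
  have h0 : sgn (u 0) = u 0 := (hs 0).trans (one_smul _ _)
  refine semiinvariant_mem (S := goodPart orbitTwo) (isStable_goodPart _ fun j f => ?_) d_mem h0 h1
  change twoForm (orbit (polyA j * f)) = incl (polyA j) * twoForm (orbit f)
  rw [incl_mul_twoForm, orbit_mul (cyc_polyA j)]

theorem invariants_le_adjoin : invariants ≤ Algebra.adjoin F3 generators := by
  intro r hr
  rw [← form_coords r, form_mem_invariants] at hr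
  obtain ⟨⟨hs, hc⟩, ⟨hs1, hc1⟩, ⟨hs2, hc2⟩, hs3, hc3⟩ := hr
  rw [← form_coords r, form_eq]
  exact add_mem (add_mem (add_mem (incl_mem hs hc) (oneForm_mem hs1 hc1)) (twoForm_mem hs2 hc2))
    (mul_mem (incl_mem hs3 hc3) (gen_mem (.inr (.inr (.inr ())))))

theorem sgn_polyA (j : Fin 4) : sgn (polyA j) = polyA j := by
  fin_cases j <;> simp [polyA, sgn_X, sign, Even.neg_pow (by decide : Even 4)]

theorem sgn_orbit_polyC (j : Fin 6) (i : Fin 3) :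
    sgn (orbit (polyC j) i) = sign i • orbit (polyC j) i := by
  fin_cases j <;> fin_cases i <;>
    simp [orbit, polyC, cyc_X0, cyc_X1, cyc_X2, sgn_X, sign, Odd.neg_pow (by decide : Odd 3)]

theorem orbit_succ (f : P) (i : Fin 3) : orbit f (i + 1) = cyc (orbit f i) := by
  fin_cases i
  exacts [rfl, rfl, (cyc_cyc_cyc f).symm]

theorem orbit_mem (j : Fin 6) :
    (∀ i, sgn (orbit (polyC j) i) = sign i • orbit (polyC j) i) ∧
      ∀ i, orbit (polyC j) (i + 1) = cyc (orbit (polyC j) i) :=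
  ⟨sgn_orbit_polyC j, orbit_succ _⟩

theorem gen_mem_invariants (i : Idx) : gen i ∈ invariants := by
  have h0 : (∀ i, sgn ((0 : Fin 3 → P) i) = sign i • (0 : Fin 3 → P) i) ∧
      ∀ i, (0 : Fin 3 → P) (i + 1) = cyc ((0 : Fin 3 → P) i) := by simp
  have h0' : sgn 0 = 0 ∧ cyc 0 = 0 := ⟨map_zero _, map_zero _⟩
  rw [← form_coords (gen i), form_mem_invariants]
  rcases i with i | i | i | i
  · have h : coords (gen (.inl i)) = (polyA i, 0, 0, 0) := coords_incl _
    rw [h]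
    exact ⟨⟨sgn_polyA i, cyc_polyA i⟩, h0, h0, h0'⟩
  · have h : coords (gen (.inr (.inl i))) = (0, orbit (polyC i), 0, 0) := coords_oneForm _
    rw [h]
    exact ⟨h0', orbit_mem i, h0, h0'⟩
  · have h : coords (gen (.inr (.inr (.inl i)))) = (0, 0, orbit (polyD i), 0) := coords_twoForm _
    rw [h]
    exact ⟨h0', h0, orbit_mem _, h0'⟩
  · have h : coords (gen (.inr (.inr (.inr i)))) = (0, 0, 0, 1) := coords_yyy
    rw [h]
    exact ⟨h0', h0, h0, map_one _, map_one _⟩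

theorem adjoin_generators : Algebra.adjoin F3 generators = invariants := by
  refine le_antisymm (Algebra.adjoin_le ?_) invariants_le_adjoin
  rw [← range_gen]
  rintro _ ⟨i, rfl⟩
  exact gen_mem_invariants i

end DiffInv

end

theorem mainTheorem1 :
    DiffInv.IsMinimalGeneratingSet DiffInv.invariants DiffInv.generators ∧
    DiffInv.generators.ncard = 14 ∧
    DiffInv.c1 * DiffInv.c2 = -DiffInv.d4 - DiffInv.a1 * DiffInv.d1 + DiffInv.d3 ∧
    DiffInv.c1 * DiffInv.c3 =
      DiffInv.a1 * DiffInv.d2 + DiffInv.d5 - DiffInv.a2 * DiffInv.d1 ∧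
    DiffInv.c2 * DiffInv.c3 =
      -DiffInv.d6 + DiffInv.a1 * DiffInv.d4 - DiffInv.a1 * DiffInv.d3 +
        DiffInv.a2 * DiffInv.d2 - DiffInv.a3 * DiffInv.d1 - DiffInv.a1 ^ 2 * DiffInv.d1 := by
  exact ⟨⟨DiffInv.adjoin_generators, fun t ht => DiffInv.adjoin_generators ▸
    DiffInv.adjoin_ne_of_ssubset_generators t ht⟩, DiffInv.ncard_generators, DiffInv.c1_mul_c2,
    DiffInv.c1_mul_c3, DiffInv.c2_mul_c3⟩
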